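/- Notation and setting. Let $p,n\ge 1$, let $D=\mathrm{diag}\{d_1,\dots,d_p\}$ with $d_1\ge d_2\ge\dots\ge d_p>0$, and let $\varphi$ be a rational $p\times p$ matrix function with $\lim_{\lambda\to\infty}\varphi(\lambda)=\frac i2D$ and $\Im\varphi(\lambda)\ge0$ for $\Im\lambda>0$. Let $$\varphi(\lambda)=\tfrac i2D+\Theta_1^*(\beta-\lambda I_n)^{-1}\Theta_2,\qquad \beta^*-\beta=i(\Theta_2-\Theta_1)D^{-1}(\Theta_2-\Theta_1)^*,$$ where $\beta$ is an $n\times n$ matrix and $\Theta_1,\Theta_2$ are $n\times p$ matrices. Put $k(x)=\Theta_2^*e^{ix\beta^*}\Theta_1$ and $k(-x)=k(x)^*$ for $x>0$, and, for $l>0$, let $S_l$ be the operator $$(S_lf)(x)=f(x)+\int_0^l\{k_{ij}(d_ix-d_jt)\}_{i,j=1}^p f(t)\,dt\quad\text{on } L^2_p(0,l).$$ Let $\widetilde d_1>\dots>\widetilde d_k>0$ be the distinct values among the $d_i$, let $\widetilde d_{k+1}=0$, and for $2\le j\le k+1$ let $P_j$ be the diagonal projection onto the coordinates $i$ with $d_i>\widetilde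 d_j$. Put $$\mathcal A=i\begin{bmatrix}\beta^*&0\\0&\beta\end{bmatrix},\qquad \mathcal A_j^\times=\mathcal A+\begin{bmatrix}-\Theta_1\\ \Theta_2\end{bmatrix}D^{-1}P_j\,[\Theta_2^*\ \ \Theta_1^*].$$ For $l\ge0$ let the $2n\times2n$ matrix function $U=U_l$ on $[0,d_1l]$ be given by $U(0)=I_{2n}$ and $$U(y)=e^{-y\mathcal A}e^{(y-\widetilde d_jl)\mathcal A_j^\times}e^{\widetilde d_jl\mathcal A}U(\widetilde d_jl)\qquad(\widetilde d_jl\le y\le\widetilde d_{j-1}l,\ 2\le j\le k+1),$$ let $U_{21},U_{22}$ be its lower $n\times n$ blocks, and, whenever $\det U_{22}(d_1l)\ne0$, put $$P^\times=P^\times_l=\begin{bmatrix}0&0\\U_{22}(d_1l)^{-1}U_{21}(d_1l)&I_n\end{bmatrix}.$$ With $e_i$ the $i$-th unit row vector, let $T_l(x,t)=\{T_{l,ij}(x,t)\}_{i,j=1}^p$, where $$T_{l,ij}(x,t)=e_i[\Theta_2^*\ \ \Theta_1^*]e^{d_ix\mathcal A}U(d_ix)\,Q\,U(d_jt)^{-1}e^{-d_jt\mathcal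 A}\begin{bmatrix}-\Theta_1\\ \Theta_2\end{bmatrix}e_j^*,$$ with $Q=I_{2n}-P^\times$ if $d_ix>d_jt$ and $Q=-P^\times$ if $d_ix<d_jt$. For a $p$-rowed matrix function $f$ put $$(V_+^*f)(x)=f(x)+\int_0^xT_x(x,r)f(r)\,dr .$$ Finally, let $$s(x)=\tfrac12I_p+D^{-1}\Theta_2^*\int_0^xe^{iu\beta^*}du\,\Theta_1,\qquad \Phi_1(x)=\{d_is_{ij}(d_ix)\}_{i,j=1}^p,\qquad \Phi_2\equiv I_p,$$ and $\gamma(x)=\big(V_+^*[\Phi_1\ \ \Phi_2]\big)(x)$. Statement. Assume that $\det\beta\ne0$. Then: (a) For every $l>0$, $\det U_{22}(d_1l)\ne0$, the operator $S_l$ is bounded and boundedly invertible, and $S_l^{-1}=I+\int_0^lT_l(x,t)\,\cdot\,dt$. So $T_x$ in the definition of $V_+^*$ is the kernel of $S_x^{-1}$. (b) For every $x\ge0$, $$\gamma(x)=\Big(V_+^*\big[\tfrac12D+i\Theta_2^*(\beta^*)^{-1}\Theta_1\quad I_p\big]\Big)(x)-i\,[\gamma_0(x)\quad 0],$$ where,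 for $1\le s\le p$, the $s$-th row of $\gamma_0$ is $$e_s\gamma_0(x)=e_s\Big(\Theta_2^*e^{id_sx\beta^*}+[\Theta_2^*\ \ \Theta_1^*]e^{d_sx\mathcal A}U(d_sx)\big(P^\times U(d_1x)^{-1}-U(d_sx)^{-1}+I_{2n}-P^\times\big)\begin{bmatrix}I_n\\0\end{bmatrix}\Big)(\beta^*)^{-1}\Theta_1,$$ with $U=U_x$ and $P^\times=P^\times_x$, that is, with $l=x$. -/

import Mathlib

open Matrix MeasureTheory Filter Topology
open scoped ComplexOrder

namespace DDifference

noncomputable section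

/-! Throughout, `d 0 ≥ d 1 ≥ … > 0` are the diagonal entries of `D`, the matrix `β` is `n × n`, the
matrices `Θ₁`, `Θ₂` are `n × p`, and `l` is the length of the interval.  `Mᴴ` is the adjoint. -/

/-- `D = diag (d₁, …, d_p)` as a complex matrix. -/
def dMat {p : ℕ} (d : Fin p → ℝ) : Matrix (Fin p) (Fin p) ℂ :=
  diagonal fun i => (d i : ℂ)

/-- A matrix function is rational: each entry is a quotient of two polynomials, where the
denominator does not vanish. -/
def IsRational {p : ℕ} (φ : ℂ → Matrix (Fin p) (Fin p) ℂ) : Prop :=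
  ∀ i j, ∃ P Q : Polynomial ℂ, Q ≠ 0 ∧
    ∀ z : ℂ, Q.eval z ≠ 0 → φ z i j = P.eval z / Q.eval z

/-- `Im M = (M - M*) / (2 i)`. -/
def imPart {p : ℕ} (M : Matrix (Fin p) (Fin p) ℂ) : Matrix (Fin p) (Fin p) ℂ :=
  (1 / (2 * Complex.I)) • (M - Mᴴ)

/-- `φ(λ) = (i/2) D + Θ₁* (β - λ I)⁻¹ Θ₂` off the spectrum of `β`, together with the identity
`β* - β = i (Θ₂ - Θ₁) D⁻¹ (Θ₂ - Θ₁)*`. -/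
def IsRealization {p n : ℕ} (d : Fin p → ℝ) (φ : ℂ → Matrix (Fin p) (Fin p) ℂ)
    (β : Matrix (Fin n) (Fin n) ℂ) (Θ₁ Θ₂ : Matrix (Fin n) (Fin p) ℂ) : Prop :=
  (∀ z : ℂ, (β - z • (1 : Matrix (Fin n) (Fin n) ℂ)).det ≠ 0 →
    φ z = (Complex.I / 2) • dMat d + Θ₁ᴴ * (β - z • (1 : Matrix (Fin n) (Fin n) ℂ))⁻¹ * Θ₂) ∧
  βᴴ - β = Complex.I • ((Θ₂ - Θ₁) * (dMat d)⁻¹ * (Θ₂ - Θ₁)ᴴ)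

/-! ### The operator with `D`-difference kernel -/

/-- The matrix function `k`: `k(x) = Θ₂* exp(i x β*) Θ₁` for `x > 0`, and `k(-x) = k(x)*`. -/
def kFun {p n : ℕ} (β : Matrix (Fin n) (Fin n) ℂ) (Θ₁ Θ₂ : Matrix (Fin n) (Fin p) ℂ) (x : ℝ) :
    Matrix (Fin p) (Fin p) ℂ :=
  if 0 < x then Θ₂ᴴ * NormedSpace.exp ((Complex.I * (x : ℂ)) • βᴴ) * Θ₁
  else (Θ₂ᴴ * NormedSpace.exp ((Complex.I * ((-x : ℝ) : ℂ)) • βᴴ) * Θ₁)ᴴ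

/-- The `D`-difference kernel `k_{ij}(x,t) = k_{ij}(d_i x - d_j t)`. -/
def kKer {p n : ℕ} (d : Fin p → ℝ) (β : Matrix (Fin n) (Fin n) ℂ)
    (Θ₁ Θ₂ : Matrix (Fin n) (Fin p) ℂ) (x t : ℝ) : Matrix (Fin p) (Fin p) ℂ :=
  Matrix.of fun i j => kFun β Θ₁ Θ₂ (d i * x - d j * t) i j

/-- The Hilbert space `L²_p(0,l)`. -/
abbrev L2 (p : ℕ) (l : ℝ) : Type :=
  Lp (EuclideanSpace ℂ (Fin p)) 2 (volume.restrict (Set.Ioo 0 l))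

/-- The bounded operator `R` on `L²_p(0,l)` has the form `I + ∫₀ˡ K(x,t) · dt`. -/
def IsIdPlusIntegral {p : ℕ} (l : ℝ) (K : ℝ → ℝ → Matrix (Fin p) (Fin p) ℂ)
    (R : L2 p l →L[ℂ] L2 p l) : Prop :=
  ∀ f : L2 p l, ∀ᵐ x ∂(volume.restrict (Set.Ioo 0 l)), ∀ i : Fin p,
    (R f) x i = f x i + ∫ t in (0 : ℝ)..l, (K x t *ᵥ (f t).ofLp) i

/-! ### The matrix function `U` and the matrix `P^×` -/

/-- The `2n × 2n` matrix `𝒜 = i diag(β*, β)`. -/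
def calA {n : ℕ} (β : Matrix (Fin n) (Fin n) ℂ) : Matrix (Fin n ⊕ Fin n) (Fin n ⊕ Fin n) ℂ :=
  Complex.I • fromBlocks βᴴ 0 0 β

/-- The block column `[-Θ₁; Θ₂]`. -/
def thetaCol {p n : ℕ} (Θ₁ Θ₂ : Matrix (Fin n) (Fin p) ℂ) :
    Matrix (Fin n ⊕ Fin n) (Fin p) ℂ :=
  fromRows (-Θ₁) Θ₂

/-- The block row `[Θ₂*  Θ₁*]`. -/
def thetaRow {p n : ℕ} (Θ₁ Θ₂ : Matrix (Fin n) (Fin p) ℂ) :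
    Matrix (Fin p) (Fin n ⊕ Fin n) ℂ :=
  fromCols Θ₂ᴴ Θ₁ᴴ

/-- The diagonal projection onto the coordinates `i` with `d_i > τ`.  If `τ` is the `j`-th largest
of the distinct values of `d`, this is `P_j = diag(I_{p_1}, …, I_{p_{j-1}}, 0, …, 0)`; for `τ = 0`
it is the identity matrix. -/
def proj {p : ℕ} (d : Fin p → ℝ) (τ : ℝ) : Matrix (Fin p) (Fin p) ℂ :=
  diagonal fun i => if τ < d i then 1 else 0

/-- `𝒜_j^× = 𝒜 + [-Θ₁; Θ₂] D⁻¹ P_j [Θ₂*  Θ₁*]`, where `τ` is the `j`-th distinct value of `d`. -/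
def calAx {p n : ℕ} (d : Fin p → ℝ) (β : Matrix (Fin n) (Fin n) ℂ)
    (Θ₁ Θ₂ : Matrix (Fin n) (Fin p) ℂ) (τ : ℝ) : Matrix (Fin n ⊕ Fin n) (Fin n ⊕ Fin n) ℂ :=
  calA β + thetaCol Θ₁ Θ₂ * (dMat d)⁻¹ * proj d τ * thetaRow Θ₁ Θ₂

/-- `exp(-y 𝒜) exp((y - τ l) 𝒜^×) exp(τ l 𝒜) U₀`, where `U₀` is the value at `y = τ l`. -/
def uStep {p n : ℕ} (d : Fin p → ℝ) (β : Matrix (Fin n) (Fin n) ℂ)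
    (Θ₁ Θ₂ : Matrix (Fin n) (Fin p) ℂ) (l τ : ℝ)
    (U₀ : Matrix (Fin n ⊕ Fin n) (Fin n ⊕ Fin n) ℂ) (y : ℝ) :
    Matrix (Fin n ⊕ Fin n) (Fin n ⊕ Fin n) ℂ :=
  NormedSpace.exp (-(y : ℂ) • calA β) *
    NormedSpace.exp (((y - τ * l : ℝ) : ℂ) • calAx d β Θ₁ Θ₂ τ) *
    NormedSpace.exp (((τ * l : ℝ) : ℂ) • calA β) * U₀

/-- Continuation from the node `τ l`, with value `U₀` there, through the following nodes
`τ' l`, `τ'` in the (increasing) list. -/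
def uAux {p n : ℕ} (d : Fin p → ℝ) (β : Matrix (Fin n) (Fin n) ℂ)
    (Θ₁ Θ₂ : Matrix (Fin n) (Fin p) ℂ) (l : ℝ) :
    List ℝ → ℝ → Matrix (Fin n ⊕ Fin n) (Fin n ⊕ Fin n) ℂ → ℝ →
      Matrix (Fin n ⊕ Fin n) (Fin n ⊕ Fin n) ℂ
  | [], τ, U₀, y => uStep d β Θ₁ Θ₂ l τ U₀ y
  | τ' :: L, τ, U₀, y =>
      if y ≤ τ' * l then uStep d β Θ₁ Θ₂ l τ U₀ y
      else uAux d β Θ₁ Θ₂ l L τ' (uStep d β Θ₁ Θ₂ l τ U₀ (τ' * l)) y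

/-- The matrix function `U = U_l` on `[0, d₁ l]`: `U(0) = I`, and between two consecutive nodes
`τ l ≤ y ≤ τ' l`, where `τ < τ'` are consecutive elements of `{0} ∪ {d_1, …, d_p}`,
`U(y) = exp(-y 𝒜) exp((y - τ l) 𝒜^×) exp(τ l 𝒜) U(τ l)`. -/
def U {p n : ℕ} (d : Fin p → ℝ) (β : Matrix (Fin n) (Fin n) ℂ)
    (Θ₁ Θ₂ : Matrix (Fin n) (Fin p) ℂ) (l y : ℝ) : Matrix (Fin n ⊕ Fin n) (Fin n ⊕ Fin n) ℂ :=
  uAux d β Θ₁ Θ₂ l ((Finset.univ.image d).sort (· ≤ ·)) 0 1 y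

/-- `P^× = [0, 0; U₂₂(a)⁻¹ U₂₁(a), I]` with `a = d₁ l`. -/
def Px {p n : ℕ} [NeZero p] (d : Fin p → ℝ) (β : Matrix (Fin n) (Fin n) ℂ)
    (Θ₁ Θ₂ : Matrix (Fin n) (Fin p) ℂ) (l : ℝ) : Matrix (Fin n ⊕ Fin n) (Fin n ⊕ Fin n) ℂ :=
  fromBlocks 0 0
    ((U d β Θ₁ Θ₂ l (d 0 * l)).toBlocks₂₂⁻¹ * (U d β Θ₁ Θ₂ l (d 0 * l)).toBlocks₂₁) 1

/-- The kernel `T_l(x,t)` of the inverse operator `S_l⁻¹ = I + ∫₀ˡ T_l(x,t) · dt`. -/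
def TKer {p n : ℕ} [NeZero p] (d : Fin p → ℝ) (β : Matrix (Fin n) (Fin n) ℂ)
    (Θ₁ Θ₂ : Matrix (Fin n) (Fin p) ℂ) (l x t : ℝ) : Matrix (Fin p) (Fin p) ℂ :=
  Matrix.of fun i j =>
    if d j * t < d i * x then
      (thetaRow Θ₁ Θ₂ * NormedSpace.exp (((d i * x : ℝ) : ℂ) • calA β) *
        U d β Θ₁ Θ₂ l (d i * x) * (1 - Px d β Θ₁ Θ₂ l) * (U d β Θ₁ Θ₂ l (d j * t))⁻¹ *
        NormedSpace.exp (-((d j * t : ℝ) : ℂ) • calA β) * thetaCol Θ₁ Θ₂ :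
          Matrix (Fin p) (Fin p) ℂ) i j
    else
      -(thetaRow Θ₁ Θ₂ * NormedSpace.exp (((d i * x : ℝ) : ℂ) • calA β) *
        U d β Θ₁ Θ₂ l (d i * x) * Px d β Θ₁ Θ₂ l * (U d β Θ₁ Θ₂ l (d j * t))⁻¹ *
        NormedSpace.exp (-((d j * t : ℝ) : ℂ) • calA β) * thetaCol Θ₁ Θ₂ :
          Matrix (Fin p) (Fin p) ℂ) i j

/-! ### The operator `V_+^*` and the matrix functions `γ` and `γ₀` -/

/-- `(V_+^* f)(x) = f(x) + ∫₀ˣ T_x(x,r) f(r) dr`, applied columnwise to a matrix function `f`. -/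
def VStar {p n : ℕ} [NeZero p] {κ : Type} (d : Fin p → ℝ) (β : Matrix (Fin n) (Fin n) ℂ)
    (Θ₁ Θ₂ : Matrix (Fin n) (Fin p) ℂ) (f : ℝ → Matrix (Fin p) κ ℂ) (x : ℝ) :
    Matrix (Fin p) κ ℂ :=
  f x + Matrix.of fun i j => ∫ r in (0 : ℝ)..x, (TKer d β Θ₁ Θ₂ x x r * f r) i j

/-- `s(x) = ½ I + D⁻¹ Θ₂* ∫₀ˣ exp(i u β*) du Θ₁`. -/
def sFun {p n : ℕ} (d : Fin p → ℝ) (β : Matrix (Fin n) (Fin n) ℂ)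
    (Θ₁ Θ₂ : Matrix (Fin n) (Fin p) ℂ) (x : ℝ) : Matrix (Fin p) (Fin p) ℂ :=
  (1 / 2 : ℂ) • (1 : Matrix (Fin p) (Fin p) ℂ) +
    (dMat d)⁻¹ * Θ₂ᴴ *
      (Matrix.of fun i j =>
        ∫ u in (0 : ℝ)..x, NormedSpace.exp ((Complex.I * (u : ℂ)) • βᴴ) i j) * Θ₁

/-- `Φ₁(x) = {d_i s_{ij}(d_i x)}`. -/
def Phi1 {p n : ℕ} (d : Fin p → ℝ) (β : Matrix (Fin n) (Fin n) ℂ)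
    (Θ₁ Θ₂ : Matrix (Fin n) (Fin p) ℂ) (x : ℝ) : Matrix (Fin p) (Fin p) ℂ :=
  Matrix.of fun i j => (d i : ℂ) * sFun d β Θ₁ Θ₂ (d i * x) i j

/-- `γ(x) = (V_+^* [Φ₁  Φ₂])(x)` with `Φ₂ ≡ I_p`. -/
def gamma {p n : ℕ} [NeZero p] (d : Fin p → ℝ) (β : Matrix (Fin n) (Fin n) ℂ)
    (Θ₁ Θ₂ : Matrix (Fin n) (Fin p) ℂ) (x : ℝ) : Matrix (Fin p) (Fin p ⊕ Fin p) ℂ :=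
  VStar d β Θ₁ Θ₂ (fun t => fromCols (Phi1 d β Θ₁ Θ₂ t) (1 : Matrix (Fin p) (Fin p) ℂ)) x

/-- The matrix function `γ₀`, given row by row, with `U = U_x` and `P^×` for `l = x`. -/
def gamma0 {p n : ℕ} [NeZero p] (d : Fin p → ℝ) (β : Matrix (Fin n) (Fin n) ℂ)
    (Θ₁ Θ₂ : Matrix (Fin n) (Fin p) ℂ) (x : ℝ) : Matrix (Fin p) (Fin p) ℂ :=
  Matrix.of fun s =>
    ((Θ₂ᴴ * NormedSpace.exp ((Complex.I * ((d s * x : ℝ) : ℂ)) • βᴴ) +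
        thetaRow Θ₁ Θ₂ * NormedSpace.exp (((d s * x : ℝ) : ℂ) • calA β) *
          U d β Θ₁ Θ₂ x (d s * x) *
          (Px d β Θ₁ Θ₂ x * (U d β Θ₁ Θ₂ x (d 0 * x))⁻¹ - (U d β Θ₁ Θ₂ x (d s * x))⁻¹ +
            1 - Px d β Θ₁ Θ₂ x) *
          fromRows (1 : Matrix (Fin n) (Fin n) ℂ) (0 : Matrix (Fin n) (Fin n) ℂ)) *
      (βᴴ)⁻¹ * Θ₁ : Matrix (Fin p) (Fin p) ℂ) s

end

end DDifference

/-! Both kernels are semi-separable in the rescaled variables: each has entries `X(d_i x) (χ(d_j t <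
d_i x) - Q) Y(d_j t)`. For `k` one takes `X = -c`, `Y = b`, `Q = diag(0, I)`, where `c(y) = [Θ₂*
Θ₁*] exp(y𝒜)` and `b(y) = exp(-y𝒜) [-Θ₁; Θ₂]`; for `T_l` one takes `X = cU`, `Y = U⁻¹b`, `Q = P^×`
(`kKer_eq_semiKer`, `TKer_eq_semiKer`). In a composition of two such kernels the substitution `σ =
d_j s` merges the `p` integrals over `(0, l)` into one integral over `(0, d₁ l)` with weight `W(σ) =
D⁻¹ diag(1_{σ ≤ d_j l})`. The piecewise definition of `U` says exactly that `U' = b W c U` off the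
nodes `d_j l`. Hence `b W (cU) = U'` and `(U⁻¹b) W c = (-U⁻¹)'`, so every such integral is found
from an explicit antiderivative (`sum_integral_step_mul_step`). The four relations between `diag(0,
I)`, `P^×` and `U(d₁ l)` then give `k + T + k∘T = 0 = T + k + T∘k`, and Fubini (`comp_eq_id`) turns
these into operator identities.

Invertibility of `U₂₂(d₁ l)` is an energy argument. Along `exp(y𝒜) U(y) v` the indefinite form
`2|z₁|² + 2 Re z₁* z₂` does not increase, by a Lyapunov identity equivalent to the formula for `β* -
β` on the untruncated part (`lyapunov_identity`). A vector `ξ` in the kernel of `U₂₂` would start at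
`(0, ξ)` with energy zero and end at some `(w, 0)` with energy `2|w|²`; so `w = 0`, against
invertibility of `U` (`det_U₂₂_ne_zero`).

For (b), integrating the exponential writes `Φ₁` as a constant minus `i` times the function with
rows `e_j Θ₂* exp(i d_j x β*) (β*)⁻¹ Θ₁`. Since `Θ₂* exp(iyβ*) = c(y) [I; 0]`, the same composition
formula evaluates `V_+^*` on that function, and the value is `γ₀` (`gamma0_eq`). -/

namespace DDifference

/-! ### Integral operators with bounded kernels on `L²_p(0,l)`. -/

/-- The kernel `K` is measurable and bounded on `(0,l) × (0,l)`. -/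
structure IsBoundedKernel {p : ℕ} (l : ℝ) (K : ℝ → ℝ → Matrix (Fin p) (Fin p) ℂ) : Prop where
  measurable : ∀ i j, Measurable fun z : ℝ × ℝ => K z.1 z.2 i j
  bounded : ∃ C, 0 ≤ C ∧ ∀ x ∈ Set.Ioo 0 l, ∀ t ∈ Set.Ioo 0 l, ∀ i j, ‖K x t i j‖ ≤ C

theorem integrable_norm_L2 {p : ℕ} {l : ℝ} (f : L2 p l) :
    Integrable f (volume.restrict (Set.Ioo 0 l)) :=
  (Lp.memLp f).integrable (by norm_num)

theorem exists_integral_norm_le (p : ℕ) (l : ℝ) : ∃ C, 0 ≤ C ∧ ∀ f : L2 p l,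
    ∫ t in Set.Ioo 0 l, ‖f t‖ ≤ C * ‖f‖ := by
  set μ := volume.restrict (Set.Ioo 0 l) with hμ
  -- Hölder's constant: the square root of the total mass.
  refine ⟨(μ Set.univ ^ (1 / (1 : ENNReal).toReal - 1 / (2 : ENNReal).toReal)).toReal,
    ENNReal.toReal_nonneg, fun f => ?_⟩
  have h := eLpNorm_le_eLpNorm_mul_rpow_measure_univ (p := 1) (q := 2) (μ := μ) (f := f)
    (by norm_num) (Lp.aestronglyMeasurable f)
  have hfin : μ Set.univ ^ (1 / (1 : ENNReal).toReal - 1 / (2 : ENNReal).toReal) ≠ ⊤ := by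
    apply ENNReal.rpow_ne_top_of_nonneg _ (measure_ne_top _ _)
    norm_num
  rw [integral_norm_eq_lintegral_enorm (Lp.aestronglyMeasurable f), ← eLpNorm_one_eq_lintegral_enorm,
    mul_comm, Lp.norm_def, ← ENNReal.toReal_mul]
  exact ENNReal.toReal_mono (ENNReal.mul_ne_top (Lp.eLpNorm_ne_top f) hfin) h

namespace IsBoundedKernel

variable {p : ℕ} {l : ℝ} {K T : ℝ → ℝ → Matrix (Fin p) (Fin p) ℂ}

theorem measurable_mulVec (hK : IsBoundedKernel l K) (f : L2 p l) (i : Fin p) :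
    Measurable fun z : ℝ × ℝ => (K z.1 z.2 *ᵥ (f z.2).ofLp) i := by
  have hf : ∀ j, Measurable fun t => (f t).ofLp j := fun j =>
    (measurable_pi_apply j).comp ((WithLp.measurable_ofLp (p := 2) _).comp (Lp.stronglyMeasurable f).measurable)
  simp only [mulVec, dotProduct]
  exact Finset.measurable_sum _ fun j _ => (hK.measurable i j).mul ((hf j).comp measurable_snd)

theorem norm_mulVec_le {M : Matrix (Fin p) (Fin p) ℂ} {C : ℝ} (hC : 0 ≤ C)
    (hM : ∀ i j, ‖M i j‖ ≤ C) (v : EuclideanSpace ℂ (Fin p)) (i : Fin p) :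
    ‖(M *ᵥ v.ofLp) i‖ ≤ p * C * ‖v‖ := by
  calc ‖(M *ᵥ v.ofLp) i‖ ≤ ∑ j, ‖M i j * v.ofLp j‖ := by
        rw [mulVec, dotProduct]
        exact norm_sum_le _ _
    _ ≤ ∑ _j : Fin p, C * ‖v‖ := Finset.sum_le_sum fun j _ => by
        rw [norm_mul]
        exact mul_le_mul (hM i j) (PiLp.norm_apply_le v j) (norm_nonneg _) hC
    _ = p * C * ‖v‖ := by simp [mul_assoc]

theorem integrable_mulVec (hK : IsBoundedKernel l K) (f : L2 p l) (i : Fin p) {x : ℝ}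
    (hx : x ∈ Set.Ioo 0 l) :
    IntegrableOn (fun t => (K x t *ᵥ (f t).ofLp) i) (Set.Ioo 0 l) := by
  obtain ⟨C, hC, h⟩ := hK.bounded
  refine ((integrable_norm_L2 f).norm.const_mul (p * C)).mono'
    ((hK.measurable_mulVec f i).comp measurable_prodMk_left).aestronglyMeasurable ?_
  filter_upwards [ae_restrict_mem measurableSet_Ioo] with t ht
  exact norm_mulVec_le hC (h x hx t ht) _ i

/-- The function `x ↦ ∫₀ˡ K(x,t) f(t) dt`. -/
noncomputable def integralFun (K : ℝ → ℝ → Matrix (Fin p) (Fin p) ℂ) (f : L2 p l) (x : ℝ) :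
    EuclideanSpace ℂ (Fin p) :=
  WithLp.toLp 2 fun i => ∫ t in Set.Ioo 0 l, (K x t *ᵥ (f t).ofLp) i

theorem measurable_integralFun (hK : IsBoundedKernel l K) (f : L2 p l) :
    Measurable (integralFun K f) := by
  refine (WithLp.measurable_toLp 2 _).comp (measurable_pi_lambda _ fun i => ?_)
  exact ((hK.measurable_mulVec f i).stronglyMeasurable.integral_prod_right
    (f := fun x t => (K x t *ᵥ (f t).ofLp) i)).measurable

theorem exists_norm_integralFun_le (hK : IsBoundedKernel l K) : ∃ C, 0 ≤ C ∧ ∀ f : L2 p l,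
    ∀ x ∈ Set.Ioo 0 l, ‖integralFun K f x‖ ≤ C * ‖f‖ := by
  obtain ⟨C, hC, h⟩ := hK.bounded
  obtain ⟨C', hC', h'⟩ := exists_integral_norm_le p l
  refine ⟨p * (p * C * C'), by positivity, fun f x hx => ?_⟩
  have hi : ∀ i, ‖(integralFun K f x).ofLp i‖ ≤ p * C * C' * ‖f‖ := fun i => by
    calc ‖(integralFun K f x).ofLp i‖ ≤ ∫ t in Set.Ioo 0 l, p * C * ‖f t‖ := by
          refine norm_integral_le_of_norm_le ((integrable_norm_L2 f).norm.const_mul (p * C)) ?_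
          filter_upwards [ae_restrict_mem measurableSet_Ioo] with t ht
          exact norm_mulVec_le hC (h x hx t ht) _ i
      _ = p * C * ∫ t in Set.Ioo 0 l, ‖f t‖ := integral_const_mul _ _
      _ ≤ p * C * (C' * ‖f‖) := by gcongr; exact h' f
      _ = _ := by ring
  calc ‖integralFun K f x‖ ≤ ∑ i, ‖(integralFun K f x).ofLp i‖ := by
        rw [EuclideanSpace.norm_eq]
        refine Real.sqrt_le_iff.2 ⟨by positivity, ?_⟩
        exact Finset.sum_sq_le_sq_sum_of_nonneg fun i _ => norm_nonneg _
    _ ≤ ∑ _i : Fin p, p * C * C' * ‖f‖ := Finset.sum_le_sum fun i _ => hi i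
    _ = _ := by simp; ring

theorem memLp_integralFun (hK : IsBoundedKernel l K) (f : L2 p l) :
    MemLp (integralFun K f) 2 (volume.restrict (Set.Ioo 0 l)) := by
  obtain ⟨C, -, h⟩ := hK.exists_norm_integralFun_le
  refine MemLp.of_bound (hK.measurable_integralFun f).aestronglyMeasurable (C * ‖f‖) ?_
  filter_upwards [ae_restrict_mem measurableSet_Ioo] with x hx using h f x hx

/-- The operator `f ↦ ∫₀ˡ K(·,t) f(t) dt` as a linear map. -/
noncomputable def integralLinearMap (hK : IsBoundedKernel l K) : L2 p l →ₗ[ℂ] L2 p l where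
  toFun f := (hK.memLp_integralFun f).toLp
  map_add' f g := by
    apply Lp.ext
    filter_upwards [(hK.memLp_integralFun (f + g)).coeFn_toLp, (hK.memLp_integralFun f).coeFn_toLp,
      (hK.memLp_integralFun g).coeFn_toLp,
      Lp.coeFn_add (hK.memLp_integralFun f).toLp (hK.memLp_integralFun g).toLp,
      ae_restrict_mem measurableSet_Ioo] with x h1 h2 h3 h4 hx
    rw [h1, h4, Pi.add_apply, h2, h3]
    ext i
    simp only [integralFun, PiLp.add_apply]
    rw [← integral_add (hK.integrable_mulVec f i hx) (hK.integrable_mulVec g i hx)]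
    refine integral_congr_ae ?_
    filter_upwards [Lp.coeFn_add f g] with t ht
    rw [ht, Pi.add_apply, WithLp.ofLp_add, mulVec_add, Pi.add_apply]
  map_smul' c f := by
    apply Lp.ext
    filter_upwards [(hK.memLp_integralFun (c • f)).coeFn_toLp,
      (hK.memLp_integralFun f).coeFn_toLp,
      Lp.coeFn_smul c (hK.memLp_integralFun f).toLp] with x h1 h2 h4
    rw [h1, RingHom.id_apply, h4, Pi.smul_apply, h2]
    ext i
    simp only [integralFun, PiLp.smul_apply]
    rw [← integral_smul]
    refine integral_congr_ae ?_
    filter_upwards [Lp.coeFn_smul c f] with t ht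
    rw [ht, Pi.smul_apply, WithLp.ofLp_smul, mulVec_smul, Pi.smul_apply]

theorem exists_isIdPlusIntegral (hl : 0 < l) (hK : IsBoundedKernel l K) :
    ∃ R : L2 p l →L[ℂ] L2 p l, IsIdPlusIntegral l K R := by
  obtain ⟨C, hC, h⟩ := hK.exists_norm_integralFun_le
  let μ := volume.restrict (Set.Ioo (0 : ℝ) l)
  let R₀ : L2 p l →L[ℂ] L2 p l := hK.integralLinearMap.mkContinuous
    ((measureUnivNNReal μ : ℝ) ^ (2 : ENNReal).toReal⁻¹ * C) fun f => by
      rw [mul_assoc]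
      refine Lp.norm_le_of_ae_bound (by positivity) ?_
      filter_upwards [(hK.memLp_integralFun f).coeFn_toLp, ae_restrict_mem measurableSet_Ioo]
        with x h1 hx
      exact (congrArg norm h1).le.trans (h f x hx)
  refine ⟨ContinuousLinearMap.id ℂ _ + R₀, fun f => ?_⟩
  filter_upwards [(hK.memLp_integralFun f).coeFn_toLp, Lp.coeFn_add f (R₀ f)] with x h1 h2 i
  have h3 : (ContinuousLinearMap.id ℂ (L2 p l) + R₀) f = f + R₀ f := rfl
  have h4 : (R₀ f) x = integralFun K f x := h1
  rw [h3, h2, Pi.add_apply, h4, intervalIntegral.integral_of_le hl.le, integral_Ioc_eq_integral_Ioo]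
  rfl

/-- If `K + T + K ∘ T = 0` as kernels, the operators `I + K` and `I + T` satisfy
`(I + K)(I + T) = I`. -/
theorem comp_eq_id (hl : 0 < l) (hK : IsBoundedKernel l K) (hT : IsBoundedKernel l T)
    (hKT : ∀ x ∈ Set.Ioo 0 l, ∀ t ∈ Set.Ioo 0 l, ∀ i m,
      K x t i m + T x t i m + ∑ j, ∫ s in (0 : ℝ)..l, K x s i j * T s t j m = 0)
    {S R : L2 p l →L[ℂ] L2 p l} (hS : IsIdPlusIntegral l K S) (hR : IsIdPlusIntegral l T R) :
    S ∘L R = ContinuousLinearMap.id ℂ (L2 p l) := by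
  ext1 f
  apply Lp.ext
  obtain ⟨CK, hCK, hbK⟩ := hK.bounded
  obtain ⟨CT, hCT, hbT⟩ := hT.bounded
  filter_upwards [hS (R f), hR f, ae_restrict_mem measurableSet_Ioo] with x h1 h2 hx
  ext i
  rw [ContinuousLinearMap.comp_apply, h1 i, h2 i, ContinuousLinearMap.id_apply, add_assoc]
  rw [add_eq_left]
  -- Inserting the formula for `R f` under the integral leaves a double integral with kernel `K(x,s)
  -- T(s,t)`.
  have hRf : ∀ᵐ s ∂(volume.restrict (Set.Ioo 0 l)), (K x s *ᵥ (R f s).ofLp) i =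
      (K x s *ᵥ (f s).ofLp) i +
        ∫ t in Set.Ioo 0 l, ((K x s * T s t) *ᵥ (f t).ofLp) i := by
    filter_upwards [hR f, ae_restrict_mem measurableSet_Ioo] with s hs hs'
    have h3 : (R f s).ofLp = (f s).ofLp +
        fun j => ∫ t in Set.Ioo 0 l, (T s t *ᵥ (f t).ofLp) j := by
      ext j
      rw [hs j, intervalIntegral.integral_of_le hl.le, integral_Ioc_eq_integral_Ioo]
      rfl
    rw [h3, mulVec_add, Pi.add_apply]
    congr 1
    simp only [← mulVec_mulVec]
    change ∑ j, K x s i j * (∫ t in Set.Ioo 0 l, (T s t *ᵥ (f t).ofLp) j) =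
      ∫ t in Set.Ioo 0 l, ∑ j, K x s i j * (T s t *ᵥ (f t).ofLp) j
    rw [integral_finsetSum]
    · simp only [integral_const_mul]
    · exact fun j _ => (hT.integrable_mulVec f j hs').const_mul _
  have hf : ∀ j, Measurable fun t => (f t).ofLp j := fun j =>
    (measurable_pi_apply j).comp
      ((WithLp.measurable_ofLp (p := 2) _).comp (Lp.stronglyMeasurable f).measurable)
  have hmKT : ∀ j m, Measurable fun z : ℝ × ℝ => K x z.1 i j * T z.1 z.2 j m := fun j m =>
    ((hK.measurable i j).comp (measurable_const.prodMk measurable_fst)).mul (hT.measurable j m)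
  have hbKT : ∀ s ∈ Set.Ioo 0 l, ∀ t ∈ Set.Ioo 0 l, ∀ j m, ‖K x s i j * T s t j m‖ ≤ CK * CT :=
    fun s hs t ht j m => by
      rw [norm_mul]
      exact mul_le_mul (hbK x hx s hs i j) (hbT s hs t ht j m) (norm_nonneg _) hCK
  -- Fubini applies because the integrand is dominated by a sum of multiples of `‖f t‖`.
  have hint : Integrable (Function.uncurry fun s t => ((K x s * T s t) *ᵥ (f t).ofLp) i)
      ((volume.restrict (Set.Ioo 0 l)).prod (volume.restrict (Set.Ioo 0 l))) := by
    simp only [Function.uncurry_def, mulVec, dotProduct, Matrix.mul_apply, Finset.sum_mul]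
    refine integrable_finsetSum _ fun m _ => integrable_finsetSum _ fun j _ => ?_
    have hg : Integrable (fun z : ℝ × ℝ => CK * CT * ‖f z.2‖)
        ((volume.restrict (Set.Ioo 0 l)).prod (volume.restrict (Set.Ioo 0 l))) :=
      ((integrable_norm_L2 f).norm.comp_snd _).const_mul _
    refine hg.mono' ((hmKT j m).mul ((hf m).comp measurable_snd)).aestronglyMeasurable ?_
    rw [Measure.prod_restrict]
    filter_upwards [ae_restrict_mem (measurableSet_Ioo.prod measurableSet_Ioo)] with z hz
    rw [norm_mul]
    exact mul_le_mul (hbKT _ hz.1 _ hz.2 j m) (PiLp.norm_apply_le _ m) (norm_nonneg _)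
      (by positivity)
  have hint' : IntegrableOn (fun s => ∫ t in Set.Ioo 0 l, ((K x s * T s t) *ᵥ (f t).ofLp) i)
      (Set.Ioo 0 l) := hint.integral_prod_left
  have hswap := integral_integral_swap hint
  -- After the swap the inner integral is the composed kernel, which the kernel identity replaces by
  -- `-(K + T)`.
  have hinner : ∀ t ∈ Set.Ioo 0 l, ∫ s in Set.Ioo 0 l, ((K x s * T s t) *ᵥ (f t).ofLp) i =
      -(((K x t) *ᵥ (f t).ofLp) i + (T x t *ᵥ (f t).ofLp) i) := by
    intro t ht
    have hi : ∀ j m, IntegrableOn (fun s => K x s i j * T s t j m) (Set.Ioo 0 l) := fun j m => by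
      refine (integrable_const (CK * CT)).mono'
        ((hmKT j m).comp measurable_prodMk_right).aestronglyMeasurable ?_
      filter_upwards [ae_restrict_mem measurableSet_Ioo] with s hs using hbKT s hs t ht j m
    simp only [mulVec, dotProduct, Matrix.mul_apply, Finset.sum_mul]
    rw [integral_finsetSum _ fun m _ => integrable_finsetSum _ fun j _ => (hi j m).mul_const _,
      ← Finset.sum_add_distrib, ← Finset.sum_neg_distrib]
    refine Finset.sum_congr rfl fun m _ => ?_
    rw [integral_finsetSum _ fun j _ => (hi j m).mul_const _]
    simp only [integral_mul_const]
    rw [← Finset.sum_mul]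
    have := hKT x hx t ht i m
    simp only [intervalIntegral.integral_of_le hl.le, integral_Ioc_eq_integral_Ioo] at this
    linear_combination (f t).ofLp m * this
  rw [intervalIntegral.integral_of_le hl.le, intervalIntegral.integral_of_le hl.le,
    integral_Ioc_eq_integral_Ioo, integral_Ioc_eq_integral_Ioo, integral_congr_ae hRf,
    integral_add (hK.integrable_mulVec f i hx) hint', hswap,
    setIntegral_congr_fun measurableSet_Ioo hinner, integral_neg,
    integral_add (hK.integrable_mulVec f i hx) (hT.integrable_mulVec f i hx)]
  ring

end IsBoundedKernel

/-! ### The differential equation for `U`. -/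

section Fundamental

attribute [local instance] Matrix.linftyOpNormedRing Matrix.linftyOpNormedAlgebra

section Exp

variable {m : Type*} [Fintype m] [DecidableEq m]

theorem hasDerivAt_exp_ofReal_smul (A : Matrix m m ℂ) (y : ℝ) :
    HasDerivAt (fun y : ℝ => NormedSpace.exp ((y : ℂ) • A))
      (NormedSpace.exp ((y : ℂ) • A) * A) y := by
  have h := (hasDerivAt_exp_smul_const A (y : ℂ)).scomp y Complex.ofRealCLM.hasDerivAt
  rw [Complex.ofRealCLM_apply, Complex.ofReal_one, one_smul] at h
  exact h

theorem hasDerivAt_exp_neg_ofReal_smul (A : Matrix m m ℂ) (y : ℝ) :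
    HasDerivAt (fun y : ℝ => NormedSpace.exp (-(y : ℂ) • A))
      (-(NormedSpace.exp (-(y : ℂ) • A) * A)) y := by
  have h := hasDerivAt_exp_ofReal_smul (-A) y
  simpa only [smul_neg, neg_smul, mul_neg] using h

theorem exp_ofReal_smul_mul_comm (A : Matrix m m ℂ) (z : ℂ) :
    NormedSpace.exp (z • A) * A = A * NormedSpace.exp (z • A) :=
  (((Commute.refl A).smul_left z).exp_left).eq

theorem exp_smul_mul_exp_neg_smul (A : Matrix m m ℂ) (z : ℂ) :
    NormedSpace.exp (z • A) * NormedSpace.exp (-z • A) = 1 := by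
  rw [← Matrix.exp_add_of_commute _ _ (((Commute.refl A).smul_left z).smul_right (-z)), neg_smul,
    add_neg_cancel, NormedSpace.exp_zero]

theorem exp_neg_smul_mul_exp_smul (A : Matrix m m ℂ) (z : ℂ) :
    NormedSpace.exp (-z • A) * NormedSpace.exp (z • A) = 1 := by
  simpa using exp_smul_mul_exp_neg_smul A (-z)

theorem continuous_exp_ofReal_smul (A : Matrix m m ℂ) :
    Continuous fun y : ℝ => NormedSpace.exp ((y : ℂ) • A) :=
  continuous_iff_continuousAt.2 fun y => (hasDerivAt_exp_ofReal_smul A y).continuousAt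

theorem continuous_exp_neg_ofReal_smul (A : Matrix m m ℂ) :
    Continuous fun y : ℝ => NormedSpace.exp (-(y : ℂ) • A) :=
  continuous_iff_continuousAt.2 fun y => (hasDerivAt_exp_neg_ofReal_smul A y).continuousAt

end Exp

variable {p n : ℕ} (d : Fin p → ℝ) (β : Matrix (Fin n) (Fin n) ℂ)
  (Θ₁ Θ₂ : Matrix (Fin n) (Fin p) ℂ) (l : ℝ)

/-- `exp(-y 𝒜) [-Θ₁; Θ₂]`. -/
noncomputable def bFun (y : ℝ) : Matrix (Fin n ⊕ Fin n) (Fin p) ℂ :=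
  NormedSpace.exp (-(y : ℂ) • calA β) * thetaCol Θ₁ Θ₂

/-- `[Θ₂* Θ₁*] exp(y 𝒜)`. -/
noncomputable def cFun (y : ℝ) : Matrix (Fin p) (Fin n ⊕ Fin n) ℂ :=
  thetaRow Θ₁ Θ₂ * NormedSpace.exp ((y : ℂ) • calA β)

/-- The weight `D⁻¹ diag(1_{y ≤ d_j l})`. -/
noncomputable def wMat (y : ℝ) : Matrix (Fin p) (Fin p) ℂ :=
  diagonal fun j => if y ≤ d j * l then (d j : ℂ)⁻¹ else 0

/-- The coefficient of the differential equation `U' = M U`. -/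
noncomputable def mFun (y : ℝ) : Matrix (Fin n ⊕ Fin n) (Fin n ⊕ Fin n) ℂ :=
  bFun β Θ₁ Θ₂ y * wMat d l y * cFun β Θ₁ Θ₂ y

theorem continuous_bFun : Continuous (bFun β Θ₁ Θ₂) :=
  (continuous_exp_neg_ofReal_smul _).matrix_mul continuous_const

theorem continuous_cFun : Continuous (cFun β Θ₁ Θ₂) :=
  continuous_const.matrix_mul (continuous_exp_ofReal_smul _)

theorem dMat_inv {d : Fin p → ℝ} (hd0 : ∀ i, 0 < d i) :
    (dMat d)⁻¹ = diagonal fun i => (d i : ℂ)⁻¹ := by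
  have h : ∀ i, (d i : ℂ) ≠ 0 := fun i => by exact_mod_cast (hd0 i).ne'
  refine Matrix.inv_eq_right_inv ?_
  rw [dMat, diagonal_mul_diagonal, ← diagonal_one]
  exact congrArg _ (funext fun i => mul_inv_cancel₀ (h i))

theorem uStep_node (τ : ℝ) (U₀ : Matrix (Fin n ⊕ Fin n) (Fin n ⊕ Fin n) ℂ) :
    uStep d β Θ₁ Θ₂ l τ U₀ (τ * l) = U₀ := by
  rw [uStep, sub_self, Complex.ofReal_zero, zero_smul, NormedSpace.exp_zero, mul_one,
    exp_neg_smul_mul_exp_smul, one_mul]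

/-- The derivative brings down `𝒜^× - 𝒜`, the product of the block column and block row with `D⁻¹ P`
in between; the factor `exp(y𝒜)` in `cFun` cancels the leading `exp(-y𝒜)` of the step. -/
theorem hasDerivAt_uStep (τ : ℝ) (U₀ : Matrix (Fin n ⊕ Fin n) (Fin n ⊕ Fin n) ℂ) (y : ℝ) :
    HasDerivAt (uStep d β Θ₁ Θ₂ l τ U₀)
      (bFun β Θ₁ Θ₂ y * ((dMat d)⁻¹ * proj d τ) * cFun β Θ₁ Θ₂ y *
        uStep d β Θ₁ Θ₂ l τ U₀ y) y := by
  have h1 := hasDerivAt_exp_neg_ofReal_smul (calA β) y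
  have h2 := (hasDerivAt_exp_ofReal_smul (calAx d β Θ₁ Θ₂ τ) (y - τ * l)).comp_sub_const y (τ * l)
  have h3 := ((h1.mul h2).mul_const (NormedSpace.exp (((τ * l : ℝ) : ℂ) • calA β))).mul_const U₀
  refine h3.congr_deriv ?_
  rw [exp_ofReal_smul_mul_comm (calAx d β Θ₁ Θ₂ τ), uStep, bFun, cFun]
  set E := NormedSpace.exp (((y - τ * l : ℝ) : ℂ) • calAx d β Θ₁ Θ₂ τ)
  set F := NormedSpace.exp (((τ * l : ℝ) : ℂ) • calA β)
  have hA := exp_smul_mul_exp_neg_smul (calA β) y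
  set X := NormedSpace.exp (-(y : ℂ) • calA β)
  set X' := NormedSpace.exp ((y : ℂ) • calA β)
  have h4 : X * thetaCol Θ₁ Θ₂ * ((dMat d)⁻¹ * proj d τ) * (thetaRow Θ₁ Θ₂ * X') * (X * E * F * U₀)
      = X * (thetaCol Θ₁ Θ₂ * (dMat d)⁻¹ * proj d τ * thetaRow Θ₁ Θ₂) * ((X' * X) * E * F * U₀) := by
    simp only [Matrix.mul_assoc]
  rw [h4, hA, calAx]
  generalize thetaCol Θ₁ Θ₂ * (dMat d)⁻¹ * proj d τ * thetaRow Θ₁ Θ₂ = G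
  noncomm_ring

theorem isUnit_uStep (τ : ℝ) {U₀ : Matrix (Fin n ⊕ Fin n) (Fin n ⊕ Fin n) ℂ} (hU : IsUnit U₀)
    (y : ℝ) : IsUnit (uStep d β Θ₁ Θ₂ l τ U₀ y) :=
  (((Matrix.isUnit_exp _).mul (Matrix.isUnit_exp _)).mul (Matrix.isUnit_exp _)).mul hU

variable {l}

theorem uAux_node (hl : 0 ≤ l) (L : List ℝ) (τ : ℝ) (hL : (τ :: L).Pairwise (· ≤ ·))
    (U₀ : Matrix (Fin n ⊕ Fin n) (Fin n ⊕ Fin n) ℂ) :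
    uAux d β Θ₁ Θ₂ l L τ U₀ (τ * l) = U₀ := by
  cases L with
  | nil => exact uStep_node ..
  | cons τ' L =>
    rw [uAux, if_pos, uStep_node]
    exact mul_le_mul_of_nonneg_right (List.rel_of_pairwise_cons hL (by simp)) hl

theorem isUnit_uAux (L : List ℝ) (τ : ℝ) {U₀ : Matrix (Fin n ⊕ Fin n) (Fin n ⊕ Fin n) ℂ}
    (hU : IsUnit U₀) (y : ℝ) : IsUnit (uAux d β Θ₁ Θ₂ l L τ U₀ y) := by
  induction L generalizing τ U₀ with
  | nil => exact isUnit_uStep d β Θ₁ Θ₂ l τ hU y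
  | cons τ' L ih =>
    rw [uAux]
    split_ifs
    · exact isUnit_uStep d β Θ₁ Θ₂ l τ hU y
    · exact ih _ (isUnit_uStep d β Θ₁ Θ₂ l τ hU _)

/-- The formulas on the two sides of a node agree there, since each continuation starts from the
value already reached. -/
theorem continuous_uAux (hl : 0 ≤ l) (L : List ℝ) (τ : ℝ) (hL : (τ :: L).Pairwise (· ≤ ·))
    (U₀ : Matrix (Fin n ⊕ Fin n) (Fin n ⊕ Fin n) ℂ) : Continuous (uAux d β Θ₁ Θ₂ l L τ U₀) := by
  have hc : ∀ τ U₀, Continuous (uStep d β Θ₁ Θ₂ l τ U₀) := fun τ U₀ =>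
    continuous_iff_continuousAt.2 fun y => (hasDerivAt_uStep d β Θ₁ Θ₂ l τ U₀ y).continuousAt
  induction L generalizing τ U₀ with
  | nil => exact hc τ U₀
  | cons τ' L ih =>
    refine Continuous.if_le (hc _ _) (ih τ' (List.Pairwise.of_cons hL) _) continuous_id
      continuous_const ?_
    rintro y rfl
    exact (uAux_node d β Θ₁ Θ₂ hl L τ' (List.Pairwise.of_cons hL) _).symm

/-- The hypotheses are the invariant of the recursion: the remaining list contains only values of
`d` and all those above `τ`, while every node coming from `d j ≤ τ` has already been passed. -/
theorem hasDerivAt_uAux (hd0 : ∀ i, 0 < d i) (hl : 0 ≤ l) (L : List ℝ) (τ : ℝ) (hL : (τ :: L).Pairwise (· ≤ ·))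
    (hLd : ∀ τ' ∈ L, ∃ j, d j = τ') (hdL : ∀ j, τ < d j → d j ∈ L)
    (U₀ : Matrix (Fin n ⊕ Fin n) (Fin n ⊕ Fin n) ℂ) {y : ℝ} (hy : ∀ j, y ≠ d j * l)
    (hτ : ∀ j, d j ≤ τ → d j * l < y) :
    HasDerivAt (uAux d β Θ₁ Θ₂ l L τ U₀)
      (mFun d β Θ₁ Θ₂ l y * uAux d β Θ₁ Θ₂ l L τ U₀ y) y := by
  -- Between consecutive nodes, `τ < d j` and `y ≤ d j * l` select the same coordinates, so the
  -- projection and the weight agree.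
  have hw : ∀ τ, (∀ j, d j ≤ τ → d j * l < y) → (∀ j, τ < d j → y ≤ d j * l) →
      (dMat d)⁻¹ * proj d τ = wMat d l y := fun τ h1 h2 => by
    rw [dMat_inv hd0, proj, wMat, diagonal_mul_diagonal]
    congr 1
    ext j
    by_cases hj : τ < d j
    · simp [hj, h2 j hj]
    · simp [hj, (h1 j (not_lt.1 hj)).not_ge]
  induction L generalizing τ U₀ with
  | nil =>
    have := hasDerivAt_uStep d β Θ₁ Θ₂ l τ U₀ y
    rwa [hw τ hτ fun j hj => absurd (hdL j hj) (by simp)] at this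
  | cons τ' L ih =>
    have hL' := List.Pairwise.of_cons hL
    have hle : ∀ σ ∈ τ' :: L, τ' ≤ σ := fun σ hσ => by
      rcases List.mem_cons.1 hσ with rfl | hσ
      · exact le_rfl
      · exact List.rel_of_pairwise_cons hL' hσ
    obtain ⟨j', hj'⟩ := hLd τ' (by simp)
    rcases lt_or_gt_of_ne (hj' ▸ hy j') with h | h
    · have := hasDerivAt_uStep d β Θ₁ Θ₂ l τ U₀ y
      rw [hw τ hτ fun j hj => h.le.trans
        (mul_le_mul_of_nonneg_right (hle _ (hdL j hj)) hl)] at this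
      have he : uAux d β Θ₁ Θ₂ l (τ' :: L) τ U₀ =ᶠ[𝓝 y] uStep d β Θ₁ Θ₂ l τ U₀ := by
        filter_upwards [Iio_mem_nhds h] with z hz
        rw [uAux, if_pos (le_of_lt hz)]
      rw [he.eq_of_nhds]
      exact this.congr_of_eventuallyEq he
    · have := ih τ' hL' (fun σ hσ => hLd σ (by simp [hσ])) (fun j hj => by
        rcases List.mem_cons.1 (hdL j ((List.rel_of_pairwise_cons hL (by simp)).trans_lt hj))
          with h | h
        · exact absurd h hj.ne'
        · exact h) (uStep d β Θ₁ Θ₂ l τ U₀ (τ' * l))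
        (fun j hj => (mul_le_mul_of_nonneg_right hj hl).trans_lt h)
      have he : uAux d β Θ₁ Θ₂ l (τ' :: L) τ U₀ =ᶠ[𝓝 y]
          uAux d β Θ₁ Θ₂ l L τ' (uStep d β Θ₁ Θ₂ l τ U₀ (τ' * l)) := by
        filter_upwards [Ioi_mem_nhds h] with z hz
        rw [uAux, if_neg (not_le_of_gt hz)]
      rw [he.eq_of_nhds]
      exact this.congr_of_eventuallyEq he

theorem pairwise_nodes {d : Fin p → ℝ} (hd0 : ∀ i, 0 < d i) :
    (0 :: (Finset.univ.image d).sort (· ≤ ·)).Pairwise (· ≤ ·) := by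
  refine List.pairwise_cons.2 ⟨fun τ hτ => ?_, Finset.pairwise_sort _ _⟩
  obtain ⟨i, -, rfl⟩ := Finset.mem_image.1 ((Finset.mem_sort _).1 hτ)
  exact (hd0 i).le

variable {d}

theorem U_zero (hd0 : ∀ i, 0 < d i) (hl : 0 ≤ l) : U d β Θ₁ Θ₂ l 0 = 1 := by
  have := uAux_node d β Θ₁ Θ₂ hl _ 0 (pairwise_nodes hd0) 1
  rwa [zero_mul] at this

theorem isUnit_U (l y : ℝ) : IsUnit (U d β Θ₁ Θ₂ l y) :=
  isUnit_uAux d β Θ₁ Θ₂ _ _ isUnit_one y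

theorem continuous_U (hd0 : ∀ i, 0 < d i) (hl : 0 ≤ l) : Continuous (U d β Θ₁ Θ₂ l) :=
  continuous_uAux d β Θ₁ Θ₂ hl _ 0 (pairwise_nodes hd0) 1

theorem hasDerivAt_U (hd0 : ∀ i, 0 < d i) (hl : 0 ≤ l) {y : ℝ}
    (hy : y ∉ Set.range fun j => d j * l) :
    HasDerivAt (U d β Θ₁ Θ₂ l) (mFun d β Θ₁ Θ₂ l y * U d β Θ₁ Θ₂ l y) y := by
  refine hasDerivAt_uAux d β Θ₁ Θ₂ hd0 hl _ 0 (pairwise_nodes hd0) ?_ ?_ 1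
    (fun j h => hy ⟨j, h.symm⟩) fun j hj => absurd (hd0 j) hj.not_gt
  · intro τ hτ
    obtain ⟨i, -, rfl⟩ := Finset.mem_image.1 ((Finset.mem_sort _).1 hτ)
    exact ⟨i, rfl⟩
  · exact fun j _ => (Finset.mem_sort _).2 (Finset.mem_image_of_mem _ (Finset.mem_univ j))

theorem hasDerivAt_matrix_inv {m : Type*} [Fintype m] [DecidableEq m] {F : ℝ → Matrix m m ℂ}
    {F' : Matrix m m ℂ} {y : ℝ} (hF : HasDerivAt F F' y) (hu : IsUnit (F y)) :
    HasDerivAt (fun y => (F y)⁻¹) (-((F y)⁻¹ * F' * (F y)⁻¹)) y := by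
  obtain ⟨u, hu⟩ := hu
  have h := hasFDerivAt_ringInverse (𝕜 := ℝ) u
  rw [hu] at h
  have h2 := h.comp_hasDerivAt y hF
  simp only [Function.comp_def, ← Matrix.nonsing_inv_eq_ringInverse] at h2
  refine h2.congr_deriv ?_
  have h3 : (↑u⁻¹ : Matrix m m ℂ) = (F y)⁻¹ := by rw [← hu, Matrix.coe_units_inv]
  simp [h3]

theorem hasDerivAt_neg_U_inv (hd0 : ∀ i, 0 < d i) (hl : 0 ≤ l) {y : ℝ}
    (hy : y ∉ Set.range fun j => d j * l) :
    HasDerivAt (fun y => -(U d β Θ₁ Θ₂ l y)⁻¹) ((U d β Θ₁ Θ₂ l y)⁻¹ * mFun d β Θ₁ Θ₂ l y) y := by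
  have hu := isUnit_U (d := d) β Θ₁ Θ₂ l y
  refine (hasDerivAt_matrix_inv (hasDerivAt_U β Θ₁ Θ₂ hd0 hl hy) hu).neg.congr_deriv ?_
  rw [neg_neg, ← Matrix.mul_assoc, Matrix.mul_assoc (_ * _),
    Matrix.mul_nonsing_inv _ ((Matrix.isUnit_iff_isUnit_det _).1 hu), mul_one]

theorem continuous_U_inv (hd0 : ∀ i, 0 < d i) (hl : 0 ≤ l) :
    Continuous fun y => (U d β Θ₁ Θ₂ l y)⁻¹ := by
  simp only [Matrix.nonsing_inv_eq_ringInverse]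
  refine continuous_iff_continuousAt.2 fun y => ?_
  obtain ⟨u, hu⟩ := isUnit_U (d := d) β Θ₁ Θ₂ l y
  have h := NormedRing.inverse_continuousAt u
  rw [hu] at h
  exact ContinuousAt.comp (f := U d β Θ₁ Θ₂ l) h (continuous_U β Θ₁ Θ₂ hd0 hl).continuousAt

end Fundamental

/-! ### Energy dissipation and invertibility of `U₂₂`. -/

section Energy

attribute [local instance] Matrix.linftyOpNormedRing Matrix.linftyOpNormedAlgebra

/-- The matrix of the quadratic form `2 |z₁|² + 2 Re z₁* z₂`. -/
def energyMat (n : ℕ) : Matrix (Fin n ⊕ Fin n) (Fin n ⊕ Fin n) ℂ :=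
  fromBlocks (2 : Matrix (Fin n) (Fin n) ℂ) 1 1 0

/-- The quadratic form `2 |z₁|² + 2 Re z₁* z₂`. -/
noncomputable def energy {n : ℕ} (z : Fin n ⊕ Fin n → ℂ) : ℝ :=
  (star z ⬝ᵥ (energyMat n *ᵥ z)).re

variable {p n : ℕ} {d : Fin p → ℝ} {β : Matrix (Fin n) (Fin n) ℂ}
  {Θ₁ Θ₂ : Matrix (Fin n) (Fin p) ℂ}

/-- Without the projection term, the off-diagonal blocks cancel and the corner is `2i(β* - β) = -2
(Θ₂ - Θ₁) D⁻¹ (Θ₂ - Θ₁)*`. The projection term completes this to a square, because `P` is a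
selfadjoint idempotent commuting with `D⁻¹`. Thus one form works for every truncation level. -/
theorem lyapunov_identity (hd0 : ∀ i, 0 < d i)
    (hβ : βᴴ - β = Complex.I • ((Θ₂ - Θ₁) * (dMat d)⁻¹ * (Θ₂ - Θ₁)ᴴ)) (τ : ℝ) :
    ∃ Y : Matrix (Fin p) (Fin n ⊕ Fin n) ℂ,
      (calAx d β Θ₁ Θ₂ τ)ᴴ * energyMat n + energyMat n * calAx d β Θ₁ Θ₂ τ =
        -(2 : ℂ) • (Yᴴ * (dMat d)⁻¹ * Y) := by
  refine ⟨fromCols ((Θ₂ - Θ₁)ᴴ) 0 - proj d τ * thetaRow Θ₁ Θ₂, ?_⟩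
  have hD : ((dMat d)⁻¹)ᴴ = (dMat d)⁻¹ := by
    rw [dMat_inv hd0, diagonal_conjTranspose]
    congr 1; ext i; simp
  have hP : (proj d τ)ᴴ = proj d τ := by
    rw [proj, diagonal_conjTranspose]
    congr 1; ext i; simp [apply_ite]
  have hPD : proj d τ * (dMat d)⁻¹ = (dMat d)⁻¹ * proj d τ := by
    rw [dMat_inv hd0, proj, diagonal_mul_diagonal, diagonal_mul_diagonal]
    simp only [mul_comm]
  have hPP : proj d τ * proj d τ = proj d τ := by
    rw [proj, diagonal_mul_diagonal]
    congr 1; ext i; simp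
  rw [calAx]
  generalize (dMat d)⁻¹ = Di at *
  generalize proj d τ = Pr at *
  have hW : ∀ {κ : Type} (X : Matrix (Fin p) κ ℂ) , Pr * (Di * X) = Di * (Pr * X) := fun X => by
    rw [← Matrix.mul_assoc, hPD, Matrix.mul_assoc]
  have hW2 : ∀ {κ : Type} (X : Matrix (Fin p) κ ℂ) , Pr * (Pr * X) = Pr * X := fun X => by
    rw [← Matrix.mul_assoc, hPP]
  have hβ' : Complex.I • βᴴ = Complex.I • β - ((Θ₂ - Θ₁) * Di * (Θ₂ - Θ₁)ᴴ) := by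
    have h := congrArg (Complex.I • ·) hβ
    simp only [smul_sub, smul_smul, Complex.I_mul_I, neg_smul, one_smul] at h
    rw [sub_eq_iff_eq_add'.1 h]
    abel
  have hX2 : ∀ {κ : Type} (X : Matrix κ (Fin n) ℂ), X * (2 : Matrix (Fin n) (Fin n) ℂ) = X + X :=
    fun X => by rw [← one_add_one_eq_two, Matrix.mul_add, Matrix.mul_one]
  have h2X : ∀ {κ : Type} (X : Matrix (Fin n) κ ℂ), (2 : Matrix (Fin n) (Fin n) ℂ) * X = X + X :=
    fun X => by rw [← one_add_one_eq_two, Matrix.add_mul, Matrix.one_mul]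
  have h12 : fromCols ((Θ₂ - Θ₁)ᴴ) (0 : Matrix (Fin p) (Fin n) ℂ) - Pr * thetaRow Θ₁ Θ₂ =
      fromCols ((Θ₂ - Θ₁)ᴴ - Pr * Θ₂ᴴ) (-(Pr * Θ₁ᴴ)) := by
    rw [thetaRow, mul_fromCols]
    ext i (j | j) <;> simp
  rw [h12, calA, thetaCol, thetaRow, energyMat, conjTranspose_fromCols_eq_fromRows_conjTranspose]
  simp only [fromRows_mul, mul_fromCols, fromCols_fromRows_eq_fromBlocks, fromBlocks_smul, fromBlocks_add,
    fromBlocks_conjTranspose, fromBlocks_multiply]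
  congr 1
  all_goals
    simp only [conjTranspose_add, conjTranspose_sub, conjTranspose_smul, conjTranspose_mul,
      conjTranspose_neg, conjTranspose_conjTranspose, hD, hP, Complex.star_def, Complex.conj_I,
      Matrix.mul_assoc, Matrix.mul_sub, Matrix.sub_mul, Matrix.mul_neg, Matrix.neg_mul, hW, hW2,
      hβ', smul_zero, zero_add, neg_smul, two_smul, Matrix.mul_zero, Matrix.mul_one,
      Matrix.one_mul, Matrix.mul_add, add_zero, Matrix.zero_mul,
      hX2, h2X]
    abel

/-- By the Lyapunov identity the derivative is `-2 v* D⁻¹ v` with `v = Y exp(s𝒜^×) z`, and `D⁻¹` is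
positive. -/
theorem energy_exp_antitone (hd0 : ∀ i, 0 < d i)
    (hβ : βᴴ - β = Complex.I • ((Θ₂ - Θ₁) * (dMat d)⁻¹ * (Θ₂ - Θ₁)ᴴ)) (τ : ℝ)
    (z : Fin n ⊕ Fin n → ℂ) :
    Antitone fun s : ℝ => energy (NormedSpace.exp ((s : ℂ) • calAx d β Θ₁ Θ₂ τ) *ᵥ z) := by
  obtain ⟨Y, hY⟩ := lyapunov_identity (d := d) (β := β) hd0 hβ τ
  set A := calAx d β Θ₁ Θ₂ τ
  -- The value of a quadratic form at the fixed vector `z` is real-linear in its matrix, so the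
  -- product rule is needed only for matrices.
  let ψ₀ : Matrix (Fin n ⊕ Fin n) (Fin n ⊕ Fin n) ℂ →ₗ[ℝ] ℝ :=
    { toFun := fun M => (star z ⬝ᵥ (M *ᵥ z)).re
      map_add' := fun M N => by simp [add_mulVec, dotProduct_add]
      map_smul' := fun c M => by simp [smul_mulVec, dotProduct_smul] }
  let ψ := LinearMap.toContinuousLinearMap ψ₀
  have hψ : ∀ M, ψ M = (star z ⬝ᵥ (M *ᵥ z)).re := fun M => rfl
  have hE : ∀ s : ℝ, energy (NormedSpace.exp ((s : ℂ) • A) *ᵥ z) =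
      ψ (NormedSpace.exp ((s : ℂ) • Aᴴ) * energyMat n * NormedSpace.exp ((s : ℂ) • A)) := fun s => by
    have h : NormedSpace.exp ((s : ℂ) • Aᴴ) = (NormedSpace.exp ((s : ℂ) • A))ᴴ := by
      rw [← Matrix.exp_conjTranspose, conjTranspose_smul]
      simp
    rw [hψ, h, energy, star_mulVec, ← dotProduct_mulVec, mulVec_mulVec, mulVec_mulVec,
      Matrix.mul_assoc]
  have hd : ∀ s : ℝ, HasDerivAt
      (fun s : ℝ => energy (NormedSpace.exp ((s : ℂ) • A) *ᵥ z))
      (ψ (NormedSpace.exp ((s : ℂ) • Aᴴ) * (-(2 : ℂ) • (Yᴴ * (dMat d)⁻¹ * Y)) *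
        NormedSpace.exp ((s : ℂ) • A))) s := fun s => by
    have h := ((hasDerivAt_exp_ofReal_smul Aᴴ s).mul_const (energyMat n)).mul
      (hasDerivAt_exp_ofReal_smul A s)
    have h2 := ψ.hasFDerivAt.comp_hasDerivAt s h
    simp only [Function.comp_def] at h2
    refine (h2.congr_deriv ?_).congr_of_eventuallyEq (Eventually.of_forall hE)
    rw [← hY, exp_ofReal_smul_mul_comm A]
    congr 1
    noncomm_ring
  refine antitone_of_hasDerivAt_nonpos hd fun s => ?_
  have h : NormedSpace.exp ((s : ℂ) • Aᴴ) = (NormedSpace.exp ((s : ℂ) • A))ᴴ := by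
    rw [← Matrix.exp_conjTranspose, conjTranspose_smul]
    simp
  have hDpos : ((dMat d)⁻¹).PosSemidef := by
    rw [dMat_inv hd0]
    refine PosSemidef.diagonal fun i => ?_
    rw [← Complex.ofReal_inv]
    exact Complex.zero_le_real.2 (inv_nonneg.2 (hd0 i).le)
  have hpos := (hDpos.conjTranspose_mul_mul_same (Y * NormedSpace.exp ((s : ℂ) • A)))
  have h3 : NormedSpace.exp ((s : ℂ) • Aᴴ) * (-(2 : ℂ) • (Yᴴ * (dMat d)⁻¹ * Y)) *
        NormedSpace.exp ((s : ℂ) • A) = (-2 : ℝ) • ((Y * NormedSpace.exp ((s : ℂ) • A))ᴴ *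
          (dMat d)⁻¹ * (Y * NormedSpace.exp ((s : ℂ) • A))) := by
    rw [h, conjTranspose_mul]
    have : ∀ M : Matrix (Fin n ⊕ Fin n) (Fin n ⊕ Fin n) ℂ, -(2 : ℂ) • M = (-2 : ℝ) • M :=
      fun M => by ext i j; simp
    rw [this, Matrix.mul_smul, Matrix.smul_mul]
    simp only [Matrix.mul_assoc]
  rw [h3, map_smul, hψ, smul_eq_mul]
  have h4 := hpos.re_dotProduct_nonneg z
  exact mul_nonpos_of_nonpos_of_nonneg (by norm_num) h4

/-- Multiplying by `exp(y𝒜)` removes the leading factor of `U`: on each piece the trajectory is a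
pure exponential flow of `𝒜_j^×`, and the pieces chain at the nodes. -/
theorem energy_uAux_le (hd0 : ∀ i, 0 < d i)
    (hβ : βᴴ - β = Complex.I • ((Θ₂ - Θ₁) * (dMat d)⁻¹ * (Θ₂ - Θ₁)ᴴ)) {l : ℝ} (hl : 0 ≤ l)
    (L : List ℝ) (τ : ℝ) (hL : (τ :: L).Pairwise (· ≤ ·))
    (U₀ : Matrix (Fin n ⊕ Fin n) (Fin n ⊕ Fin n) ℂ) {y : ℝ} (hy : τ * l ≤ y)
    (v : Fin n ⊕ Fin n → ℂ) :
    energy ((NormedSpace.exp ((y : ℂ) • calA β) * uAux d β Θ₁ Θ₂ l L τ U₀ y) *ᵥ v) ≤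
      energy ((NormedSpace.exp (((τ * l : ℝ) : ℂ) • calA β) * U₀) *ᵥ v) := by
  have hstep : ∀ τ U₀ (y : ℝ), τ * l ≤ y →
      energy ((NormedSpace.exp ((y : ℂ) • calA β) * uStep d β Θ₁ Θ₂ l τ U₀ y) *ᵥ v) ≤
      energy ((NormedSpace.exp (((τ * l : ℝ) : ℂ) • calA β) * U₀) *ᵥ v) := fun τ U₀ y hy => by
    have h := energy_exp_antitone (β := β) hd0 hβ τ
      ((NormedSpace.exp (((τ * l : ℝ) : ℂ) • calA β) * U₀) *ᵥ v) (sub_nonneg.2 hy)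
    simp only [Complex.ofReal_zero, zero_smul, NormedSpace.exp_zero, one_mulVec] at h
    rw [mulVec_mulVec] at h
    rw [uStep]
    rwa [Matrix.mul_assoc, Matrix.mul_assoc, ← Matrix.mul_assoc, exp_smul_mul_exp_neg_smul,
      one_mul]
  induction L generalizing τ U₀ with
  | nil => exact hstep τ U₀ y hy
  | cons τ' L ih =>
    rw [uAux]
    split_ifs with h
    · exact hstep τ U₀ y hy
    · exact (ih τ' (List.Pairwise.of_cons hL) _ (not_le.1 h).le).trans (hstep τ U₀ _
        (mul_le_mul_of_nonneg_right (List.rel_of_pairwise_cons hL (by simp)) hl))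

theorem energy_U_le (hd0 : ∀ i, 0 < d i)
    (hβ : βᴴ - β = Complex.I • ((Θ₂ - Θ₁) * (dMat d)⁻¹ * (Θ₂ - Θ₁)ᴴ)) {l : ℝ} (hl : 0 ≤ l)
    {y : ℝ} (hy : 0 ≤ y) (v : Fin n ⊕ Fin n → ℂ) :
    energy ((NormedSpace.exp ((y : ℂ) • calA β) * U d β Θ₁ Θ₂ l y) *ᵥ v) ≤ energy v := by
  have h := energy_uAux_le (β := β) hd0 hβ hl _ 0 (pairwise_nodes hd0) 1
    (y := y) (by rwa [zero_mul]) v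
  simpa [U] using h

theorem energy_elim (a b : Fin n → ℂ) :
    energy (Sum.elim a b) = 2 * (star a ⬝ᵥ a).re + 2 * (star a ⬝ᵥ b).re := by
  have h : star (Sum.elim a b) = Sum.elim (star a) (star b) := by
    ext (i | i) <;> rfl
  have h2 : star b ⬝ᵥ a = star (star a ⬝ᵥ b) := by
    rw [star_dotProduct]
  rw [energy, energyMat, fromBlocks_mulVec, h]
  simp [h2, dotProduct_add]
  ring

theorem map_exp_prodMk {R S T : Type*} [NormedRing R] [NormedAlgebra ℚ R] [CompleteSpace R]
    [NormedRing S] [NormedAlgebra ℚ S] [CompleteSpace S] [NormedRing T] [Algebra ℚ T]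
    (f : R × S →+* T) (hf : Continuous f) (a : R) (b : S) :
    f (NormedSpace.exp a, NormedSpace.exp b) = NormedSpace.exp (f (a, b)) := by
  rw [← NormedSpace.map_exp f hf (a, b)]
  exact congrArg f (Prod.ext (Prod.fst_exp (a, b)).symm (Prod.snd_exp (a, b)).symm)

/-- Forming a block diagonal matrix is a continuous ring homomorphism from the product algebra,
hence commutes with the exponential. -/
theorem exp_fromBlocks_diagonal {m k : Type*} [Fintype m] [DecidableEq m] [Fintype k]
    [DecidableEq k] (A : Matrix m m ℂ) (B : Matrix k k ℂ) :
    NormedSpace.exp (fromBlocks A 0 0 B) =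
      fromBlocks (NormedSpace.exp A) 0 0 (NormedSpace.exp B) := by
  let f : Matrix m m ℂ × Matrix k k ℂ →+* Matrix (m ⊕ k) (m ⊕ k) ℂ :=
    { toFun := fun z => fromBlocks z.1 0 0 z.2
      map_one' := fromBlocks_one
      map_mul' := fun z w => by simp [fromBlocks_multiply]
      map_zero' := fromBlocks_zero
      map_add' := fun z w => by simp [fromBlocks_add] }
  have hf : Continuous f := Continuous.matrix_fromBlocks continuous_fst continuous_const
    continuous_const continuous_snd
  exact (map_exp_prodMk f hf A B).symm

theorem exp_calA (z : ℂ) : NormedSpace.exp (z • calA β) =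
    fromBlocks (NormedSpace.exp ((Complex.I * z) • βᴴ)) 0 0
      (NormedSpace.exp ((Complex.I * z) • β)) := by
  rw [calA, smul_smul, fromBlocks_smul, mul_comm, ← exp_fromBlocks_diagonal]
  simp only [smul_zero]

theorem det_U₂₂_ne_zero (hd0 : ∀ i, 0 < d i)
    (hβ : βᴴ - β = Complex.I • ((Θ₂ - Θ₁) * (dMat d)⁻¹ * (Θ₂ - Θ₁)ᴴ)) {l : ℝ} (hl : 0 ≤ l)
    {y : ℝ} (hy : 0 ≤ y) : (U d β Θ₁ Θ₂ l y).toBlocks₂₂.det ≠ 0 := by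
  intro hdet
  obtain ⟨ξ, hξ, h0⟩ := Matrix.exists_mulVec_eq_zero_iff.2 hdet
  have hle := energy_U_le (β := β) hd0 hβ hl hy (Sum.elim 0 ξ)
  have hU : U d β Θ₁ Θ₂ l y *ᵥ Sum.elim 0 ξ =
      Sum.elim ((U d β Θ₁ Θ₂ l y).toBlocks₁₂ *ᵥ ξ) 0 := by
    conv_lhs => rw [← fromBlocks_toBlocks (U d β Θ₁ Θ₂ l y), fromBlocks_mulVec]
    have h1 : (Sum.elim 0 ξ : Fin n ⊕ Fin n → ℂ) ∘ Sum.inl = 0 := rfl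
    have h2 : (Sum.elim 0 ξ : Fin n ⊕ Fin n → ℂ) ∘ Sum.inr = ξ := rfl
    rw [h1, h2, h0, mulVec_zero, mulVec_zero, zero_add, zero_add]
  have hz : NormedSpace.exp ((y : ℂ) • calA β) *ᵥ
      Sum.elim ((U d β Θ₁ Θ₂ l y).toBlocks₁₂ *ᵥ ξ) 0 =
      Sum.elim (NormedSpace.exp ((Complex.I * y) • βᴴ) *ᵥ
        ((U d β Θ₁ Θ₂ l y).toBlocks₁₂ *ᵥ ξ)) 0 := by
    rw [exp_calA, fromBlocks_mulVec, Sum.elim_comp_inl, Sum.elim_comp_inr]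
    simp only [mulVec_zero, zero_mulVec, add_zero]
  set w := NormedSpace.exp ((Complex.I * y) • βᴴ) *ᵥ ((U d β Θ₁ Θ₂ l y).toBlocks₁₂ *ᵥ ξ)
  rw [← mulVec_mulVec, hU, hz, energy_elim, energy_elim] at hle
  simp only [dotProduct_zero, star_zero, zero_dotProduct, Complex.zero_re] at hle
  -- The initial energy is `0` and the final one `2|w|²`; the cross terms vanish because each vector
  -- has a zero block.
  have hw0 : w = 0 := by
    have h2 := Complex.nonneg_iff.1 (dotProduct_star_self_nonneg w)
    have h3 : (star w ⬝ᵥ w).re = (w ⬝ᵥ star w).re := by rw [dotProduct_comm]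
    refine dotProduct_star_self_eq_zero.1 (Complex.ext ?_ h2.2.symm)
    rw [Complex.zero_re]
    linarith [h2.1]
  have hu : IsUnit (NormedSpace.exp ((y : ℂ) • calA β) * U d β Θ₁ Θ₂ l y) :=
    (Matrix.isUnit_exp _).mul (isUnit_U ..)
  have h3 : (NormedSpace.exp ((y : ℂ) • calA β) * U d β Θ₁ Θ₂ l y) *ᵥ Sum.elim 0 ξ = 0 := by
    rw [← mulVec_mulVec, hU, hz, hw0]
    ext (i | i) <;> rfl
  have h4 := Matrix.mulVec_injective_of_isUnit hu (h3.trans (mulVec_zero _).symm)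
  exact hξ (funext fun i => congrFun h4 (Sum.inr i))

end Energy

/-! ### Integrals with Heaviside factors on both sides of a derivative. -/

section Heaviside

variable {R : Type*}

/-- The Heaviside function with values in a ring: `1` if `r < y`, and `0` otherwise. -/
noncomputable def stepFun (R : Type*) [Zero R] [One R] (r y : ℝ) : R := if r < y then 1 else 0

theorem intervalIntegrable_ite {E : Type*} [NormedAddCommGroup E] {f g : ℝ → E} {a b : ℝ}
    {s : Set ℝ} [DecidablePred (· ∈ s)] (hs : MeasurableSet s)
    (hf : IntervalIntegrable f volume a b) (hg : IntervalIntegrable g volume a b) :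
    IntervalIntegrable (fun x => if x ∈ s then f x else g x) volume a b := by
  rw [intervalIntegrable_iff] at *
  exact Integrable.piecewise hs hf.integrableOn hg.integrableOn

variable [NormedRing R] [NormedAlgebra ℝ R] [CompleteSpace R]

/-- Over an interval where the integrand is `A F' B` with constant `A`, `B`, the fundamental theorem
of calculus gives `A (F(v) - F(u)) B`. -/
theorem integral_mul_deriv_mul {F N : ℝ → R} {S : Set ℝ} (hS : S.Countable)
    (hF : Continuous F) (hN : ∀ y ∉ S, HasDerivAt F (N y) y)
    (hi : ∀ u v, IntervalIntegrable N volume u v) {u v : ℝ} (huv : u ≤ v)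
    {A B : R} {g : ℝ → R} (hg : ∀ y ∈ Set.Ioo u v, g y = A * N y * B) :
    IntervalIntegrable g volume u v ∧ ∫ y in u..v, g y = A * (F v - F u) * B := by
  have hi' : IntervalIntegrable (fun y => A * N y * B) volume u v :=
    ((hi u v).continuousOn_mul (g := fun _ => A) continuousOn_const).mul_continuousOn
      (g := fun _ => B) continuousOn_const
  constructor
  · refine hi'.congr_uIoo ?_
    rw [Set.uIoo_of_le huv]
    exact fun y hy => (hg y hy).symm
  · rw [intervalIntegral.integral_congr_Ioo_of_le huv hg,
      integral_eq_of_hasDerivAt_off_countable_of_le (fun y => A * F y * B) _ huv hS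
        ((continuous_const.mul hF).mul continuous_const).continuousOn
        (fun y hy => ((hN y hy.2).const_mul A).mul_const B) hi', mul_sub, sub_mul]

/-- The interval is cut at `r` and `y`; on each piece both Heaviside factors are constant. If `r ≥
y` their product vanishes throughout, which accounts for the factor `stepFun R r y` in front of `F y
- F r`. -/
theorem integral_step_mul_step {F N : ℝ → R} {S : Set ℝ} (hS : S.Countable)
    (hF : Continuous F) (hN : ∀ y ∉ S, HasDerivAt F (N y) y)
    (hi : ∀ u v, IntervalIntegrable N volume u v) {a y r : ℝ}
    (hy : y ∈ Set.Icc 0 a) (hr : r ∈ Set.Icc 0 a) (Q₁ Q₂ : R) :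
    IntervalIntegrable (fun σ => (stepFun R σ y - Q₁) * N σ * (stepFun R r σ - Q₂)) volume 0 a ∧
    ∫ σ in (0 : ℝ)..a, (stepFun R σ y - Q₁) * N σ * (stepFun R r σ - Q₂) =
      stepFun R r y * (F y - F r) - (F y - F 0) * Q₂ - Q₁ * (F a - F r) +
        Q₁ * (F a - F 0) * Q₂ := by
  have key := fun {u v : ℝ} (huv : u ≤ v) (A B : R) =>
    integral_mul_deriv_mul hS hF hN hi huv (A := A) (B := B)
      (g := fun σ => (stepFun R σ y - Q₁) * N σ * (stepFun R r σ - Q₂))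
  rcases lt_or_ge r y with hry | hry
  · obtain ⟨i1, e1⟩ := key hr.1 (1 - Q₁) (0 - Q₂) fun σ hσ => by
      simp [stepFun, hσ.2.not_gt, hσ.2.trans hry]
    obtain ⟨i2, e2⟩ := key hry.le (1 - Q₁) (1 - Q₂) fun σ hσ => by
      simp [stepFun, hσ.1, hσ.2]
    obtain ⟨i3, e3⟩ := key hy.2 (0 - Q₁) (1 - Q₂) fun σ hσ => by
      simp [stepFun, hσ.1.not_gt, hry.trans hσ.1]
    refine ⟨(i1.trans i2).trans i3, ?_⟩
    rw [← intervalIntegral.integral_add_adjacent_intervals (i1.trans i2) i3,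
      ← intervalIntegral.integral_add_adjacent_intervals i1 i2, e1, e2, e3, stepFun, if_pos hry]
    noncomm_ring
  · obtain ⟨i1, e1⟩ := key hy.1 (1 - Q₁) (0 - Q₂) fun σ hσ => by
      simp [stepFun, hσ.2, (hσ.2.trans_le hry).not_gt]
    obtain ⟨i2, e2⟩ := key hry (0 - Q₁) (0 - Q₂) fun σ hσ => by
      simp [stepFun, hσ.1.not_gt, hσ.2.not_gt]
    obtain ⟨i3, e3⟩ := key hr.2 (0 - Q₁) (1 - Q₂) fun σ hσ => by
      simp [stepFun, (hry.trans_lt hσ.1).not_gt, hσ.1]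
    refine ⟨(i1.trans i2).trans i3, ?_⟩
    rw [← intervalIntegral.integral_add_adjacent_intervals (i1.trans i2) i3,
      ← intervalIntegral.integral_add_adjacent_intervals i1 i2, e1, e2, e3, stepFun,
      if_neg hry.not_gt]
    noncomm_ring

/-- A piecewise continuous sum of truncated functions is integrable. -/
theorem intervalIntegrable_sum_ite {E : Type*} [NormedAddCommGroup E] {ι : Type*} [Fintype ι]
    (τ : ι → ℝ) {G : ι → ℝ → E} (hG : ∀ j, Continuous (G j)) (u v : ℝ) :
    IntervalIntegrable (fun σ => ∑ j, if σ ≤ τ j then G j σ else 0) volume u v := by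
  have h := IntervalIntegrable.sum (μ := volume) (a := u) (b := v) Finset.univ
    (f := fun j σ => if σ ≤ τ j then G j σ else 0) fun j _ =>
    intervalIntegrable_ite (s := Set.Iic (τ j)) measurableSet_Iic ((hG j).intervalIntegrable _ _)
      (continuous_const.intervalIntegrable _ _)
  simpa only [Finset.sum_fn] using h

theorem integral_map_step_mul_step {ι : Type*} [Fintype ι] {τ : ι → ℝ} {F : ℝ → R}
    {G : ι → ℝ → R} (hF : Continuous F) (hG : ∀ j, Continuous (G j))
    (hFG : ∀ y ∉ Set.range τ, HasDerivAt F (∑ j, if y ≤ τ j then G j y else 0) y) {a y r : ℝ}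
    (hy : y ∈ Set.Icc 0 a) (hr : r ∈ Set.Icc 0 a) (Q₁ Q₂ : R) (ψ : R →L[ℝ] ℂ) :
    ∫ σ in (0 : ℝ)..a, ψ ((stepFun R σ y - Q₁) * (∑ j, if σ ≤ τ j then G j σ else 0) *
        (stepFun R r σ - Q₂)) =
      ψ (stepFun R r y * (F y - F r) - (F y - F 0) * Q₂ - Q₁ * (F a - F r) +
        Q₁ * (F a - F 0) * Q₂) := by
  obtain ⟨hi, he⟩ := integral_step_mul_step (Set.finite_range τ).countable hF hFG
    (intervalIntegrable_sum_ite τ hG) hy hr Q₁ Q₂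
  rw [← he, ψ.intervalIntegral_comp_comm hi]

end Heaviside

/-! ### Composition of semi-separable `D`-difference kernels. -/

section Composition

attribute [local instance] Matrix.linftyOpNormedRing Matrix.linftyOpNormedAlgebra

variable {m : Type*} [Fintype m] [DecidableEq m]

variable {p : ℕ} {d : Fin p → ℝ}

/-- Separating the coordinates leaves one truncation per summand; with continuous factors this gives
interval integrability despite the jumps of the weight. -/
theorem mul_wMat_mul_eq_sum {m : Type*} (l : ℝ) (Y : Matrix m (Fin p) ℂ)
    (X : Matrix (Fin p) m ℂ) (σ : ℝ) :
    Y * wMat d l σ * X = ∑ j,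
      if σ ≤ d j * l then Y * diagonal (Pi.single j (d j : ℂ)⁻¹) * X else 0 := by
  ext a b
  rw [Matrix.mul_apply, Matrix.sum_apply]
  refine Finset.sum_congr rfl fun j _ => ?_
  rw [wMat, mul_diagonal]
  split_ifs with hj
  · rw [Matrix.mul_apply, Finset.sum_eq_single j]
    · rw [mul_diagonal, Pi.single_eq_same]
    · intro k _ hk
      rw [mul_diagonal, Pi.single_eq_of_ne hk, mul_zero, zero_mul]
    · exact fun h => absurd (Finset.mem_univ j) h
  · rw [mul_zero, zero_mul, Matrix.zero_apply]

theorem intervalIntegrable_step_entries {κ : Type*} {X₁ : Matrix (Fin p) m ℂ}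
    {Y₁ : ℝ → Matrix m (Fin p) ℂ} {X₂ : ℝ → Matrix (Fin p) m ℂ} (hY₁ : Continuous Y₁)
    (hX₂ : Continuous X₂) (Q₁ Q₂ : Matrix m m ℂ) (Z : Matrix m κ ℂ) (y r u v : ℝ) (i j : Fin p)
    (k : κ) :
    IntervalIntegrable (fun σ => (X₁ * (stepFun (Matrix m m ℂ) σ y - Q₁) * Y₁ σ) i j *
      (X₂ σ * (stepFun (Matrix m m ℂ) r σ - Q₂) * Z) j k) volume u v := by
  let g : Matrix m m ℂ → Matrix m m ℂ → ℝ → ℂ := fun A B σ => (X₁ * A * Y₁ σ) i j *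
    (X₂ σ * B * Z) j k
  have hc : ∀ A B, IntervalIntegrable (g A B) volume u v := fun A B => by
    refine Continuous.intervalIntegrable (Continuous.mul ?_ ?_) _ _
    · exact (continuous_const.matrix_mul hY₁).matrix_elem i j
    · exact ((hX₂.matrix_mul continuous_const).matrix_mul continuous_const).matrix_elem j k
  have h : (fun σ => (X₁ * (stepFun (Matrix m m ℂ) σ y - Q₁) * Y₁ σ) i j *
      (X₂ σ * (stepFun (Matrix m m ℂ) r σ - Q₂) * Z) j k) = fun σ =>
      if σ ∈ Set.Iio y then
        if σ ∈ Set.Ioi r then g (1 - Q₁) (1 - Q₂) σ else g (1 - Q₁) (0 - Q₂) σ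
      else
        if σ ∈ Set.Ioi r then g (0 - Q₁) (1 - Q₂) σ else g (0 - Q₁) (0 - Q₂) σ := by
    ext σ
    simp only [stepFun, Set.mem_Iio, Set.mem_Ioi, g]
    split_ifs <;> rfl
  rw [h]
  exact intervalIntegrable_ite measurableSet_Iio
    (intervalIntegrable_ite measurableSet_Ioi (hc _ _) (hc _ _))
    (intervalIntegrable_ite measurableSet_Ioi (hc _ _) (hc _ _))

/-- Composition of two semi-separable `D`-difference kernels, computed by means of an antiderivative
`F` of `Y₁ W X₂`. -/
theorem sum_integral_step_mul_step {κ : Type*} [NeZero p] (hd : Antitone d) (hd0 : ∀ i, 0 < d i)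
    {l : ℝ} (hl : 0 ≤ l) {F : ℝ → Matrix m m ℂ} {Y₁ : ℝ → Matrix m (Fin p) ℂ}
    {X₂ : ℝ → Matrix (Fin p) m ℂ} (hY₁ : Continuous Y₁) (hX₂ : Continuous X₂)
    (hF : Continuous F) (hN : ∀ y ∉ Set.range fun j => d j * l,
      HasDerivAt F (Y₁ y * wMat d l y * X₂ y) y) {y r : ℝ} (hy : y ∈ Set.Icc 0 (d 0 * l))
    (hr : r ∈ Set.Icc 0 (d 0 * l)) (Q₁ Q₂ : Matrix m m ℂ) (X₁ : Matrix (Fin p) m ℂ)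
    (Z : Matrix m κ ℂ) (i : Fin p) (k : κ) :
    ∑ j, ∫ s in (0 : ℝ)..l, (X₁ * (stepFun (Matrix m m ℂ) (d j * s) y - Q₁) * Y₁ (d j * s)) i j *
      (X₂ (d j * s) * (stepFun (Matrix m m ℂ) r (d j * s) - Q₂) * Z) j k =
    (X₁ * (stepFun (Matrix m m ℂ) r y * (F y - F r) - (F y - F 0) * Q₂ - Q₁ * (F (d 0 * l) - F r) +
        Q₁ * (F (d 0 * l) - F 0) * Q₂) * Z) i k := by
  -- Composing with this functional passes from the ring-valued integral to a single entry of `X₁ M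
  -- Z`.
  let ψ₀ : Matrix m m ℂ →ₗ[ℝ] ℂ :=
    { toFun := fun M => (X₁ * M * Z) i k
      map_add' := fun M N => by simp [Matrix.mul_add, Matrix.add_mul]
      map_smul' := fun c M => by simp }
  let ψ := LinearMap.toContinuousLinearMap ψ₀
  have key : ∫ σ in (0 : ℝ)..(d 0 * l), (X₁ * ((stepFun (Matrix m m ℂ) σ y - Q₁) *
      (Y₁ σ * wMat d l σ * X₂ σ) * (stepFun (Matrix m m ℂ) r σ - Q₂)) * Z) i k =
      (X₁ * (stepFun (Matrix m m ℂ) r y * (F y - F r) - (F y - F 0) * Q₂ -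
        Q₁ * (F (d 0 * l) - F r) + Q₁ * (F (d 0 * l) - F 0) * Q₂) * Z) i k := by
    simp only [mul_wMat_mul_eq_sum]
    exact integral_map_step_mul_step (τ := fun j => d j * l) (F := F)
      (G := fun j σ => Y₁ σ * diagonal (Pi.single j (d j : ℂ)⁻¹) * X₂ σ) hF
      (fun j => (hY₁.matrix_mul continuous_const).matrix_mul hX₂)
      (fun y hy => by
        have := hN y hy
        rwa [mul_wMat_mul_eq_sum] at this) hy hr Q₁ Q₂ ψ
  rw [← key]
  let f : Fin p → ℝ → ℂ := fun j σ => (X₁ * (stepFun (Matrix m m ℂ) σ y - Q₁) * Y₁ σ) i j *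
      (X₂ σ * (stepFun (Matrix m m ℂ) r σ - Q₂) * Z) j k
  have hf : ∀ j u v, IntervalIntegrable (f j) volume u v := fun j u v =>
    intervalIntegrable_step_entries hY₁ hX₂ Q₁ Q₂ Z y r u v i j k
  -- Under `σ = d j * s` the range becomes `(0, d j * l)`, which lies in `(0, d 0 * l)` by
  -- monotonicity of `d`; the Jacobian and the indicator together form the `j`-th diagonal weight.
  have h1 : ∀ j, ∫ s in (0 : ℝ)..l, f j (d j * s) =
      ∫ σ in (0 : ℝ)..(d 0 * l), (d j : ℂ)⁻¹ * {σ | σ ≤ d j * l}.indicator (f j) σ := fun j => by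
    rw [intervalIntegral.integral_comp_mul_left (f j) (hd0 j).ne', mul_zero,
      intervalIntegral.integral_const_mul, intervalIntegral.integral_indicator]
    · rw [← Complex.ofReal_inv, Complex.real_smul]
    · exact ⟨mul_nonneg (hd0 j).le hl, mul_le_mul_of_nonneg_right (hd (Fin.zero_le j)) hl⟩
  change ∑ j, ∫ s in (0 : ℝ)..l, f j (d j * s) = _
  simp only [h1]
  rw [← intervalIntegral.integral_finsetSum]
  · refine intervalIntegral.integral_congr fun σ _ => ?_
    have h2 : ∀ A B : Matrix m m ℂ, X₁ * (A * (Y₁ σ * wMat d l σ * X₂ σ) * B) * Z =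
        X₁ * A * Y₁ σ * wMat d l σ * (X₂ σ * B * Z) := fun A B => by
      simp only [Matrix.mul_assoc]
    simp only [h2]
    rw [Matrix.mul_apply]
    refine Finset.sum_congr rfl fun j _ => ?_
    rw [wMat, mul_diagonal]
    by_cases hj : σ ≤ d j * l
    · simp only [Set.indicator, Set.mem_ofPred_eq, hj, if_true, f]
      ring
    · simp [Set.indicator, hj]
  · intro j _
    refine IntervalIntegrable.const_mul ?_ _
    exact intervalIntegrable_ite (s := {σ | σ ≤ d j * l}) measurableSet_Iic (hf j _ _)
      (continuous_const.intervalIntegrable _ _)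

/-- The kernel `X(d_i x) (χ(d_j t < d_i x) - Q) Y(d_j t)`. -/
noncomputable def semiKer (d : Fin p → ℝ) (X : ℝ → Matrix (Fin p) m ℂ) (Q : Matrix m m ℂ)
    (Y : ℝ → Matrix m (Fin p) ℂ) (x t : ℝ) : Matrix (Fin p) (Fin p) ℂ :=
  Matrix.of fun i j => (X (d i * x) * (stepFun (Matrix m m ℂ) (d j * t) (d i * x) - Q) * Y (d j * t)) i j

/-- Each of the two branches is continuous, hence bounded on the compact square. -/
theorem isBoundedKernel_semiKer (d : Fin p → ℝ) (l : ℝ) {X : ℝ → Matrix (Fin p) m ℂ}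
    {Y : ℝ → Matrix m (Fin p) ℂ} (hX : Continuous X) (hY : Continuous Y) (Q : Matrix m m ℂ) :
    IsBoundedKernel l (semiKer d X Q Y) := by
  let f : Matrix m m ℂ → Fin p → Fin p → ℝ × ℝ → ℂ := fun A i j z =>
    (X (d i * z.1) * A * Y (d j * z.2)) i j
  have hf : ∀ A i j, Continuous (f A i j) := fun A i j =>
    (((hX.comp (continuous_const.mul continuous_fst)).matrix_mul continuous_const).matrix_mul
      (hY.comp (continuous_const.mul continuous_snd))).matrix_elem i j
  have hite : ∀ i j (z : ℝ × ℝ), semiKer d X Q Y z.1 z.2 i j =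
      if d j * z.2 < d i * z.1 then f (1 - Q) i j z else f (0 - Q) i j z := fun i j z => by
    simp only [semiKer, stepFun, of_apply, f]
    split_ifs <;> rfl
  constructor
  · intro i j
    simp only [hite]
    exact Measurable.ite (measurableSet_lt (measurable_const.mul measurable_snd)
      (measurable_const.mul measurable_fst)) (hf _ i j).measurable (hf _ i j).measurable
  · have hb : ∀ A i j, ∃ C, ∀ z ∈ Set.Icc (0 : ℝ) l ×ˢ Set.Icc (0 : ℝ) l, ‖f A i j z‖ ≤ C :=
      fun A i j => (isCompact_Icc.prod isCompact_Icc).exists_bound_of_continuousOn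
        (hf A i j).continuousOn
    choose C hC using hb
    have hle : ∀ A i j, C A i j ≤ ∑ i, ∑ j, |C A i j| := fun A i j =>
      (le_abs_self _).trans ((Finset.single_le_sum (f := fun j => |C A i j|)
        (fun j _ => abs_nonneg _) (Finset.mem_univ j)).trans
        (Finset.single_le_sum (f := fun i => ∑ j, |C A i j|)
          (fun i _ => Finset.sum_nonneg fun j _ => abs_nonneg _) (Finset.mem_univ i)))
    refine ⟨(∑ i, ∑ j, |C (1 - Q) i j|) + ∑ i, ∑ j, |C (0 - Q) i j|, by positivity,
      fun x hx t ht i j => ?_⟩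
    have hz : (x, t) ∈ Set.Icc (0 : ℝ) l ×ˢ Set.Icc (0 : ℝ) l :=
      ⟨Set.Ioo_subset_Icc_self hx, Set.Ioo_subset_Icc_self ht⟩
    have h0 : ∀ A, 0 ≤ ∑ i, ∑ j, |C A i j| := fun A => by positivity
    rw [hite i j (x, t)]
    split_ifs
    · exact ((hC _ i j _ hz).trans (hle _ i j)).trans (le_add_of_nonneg_right (h0 _))
    · exact ((hC _ i j _ hz).trans (hle _ i j)).trans (le_add_of_nonneg_left (h0 _))

end Composition

/-! ### The resolvent identities for `k` and `T_l`. -/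

section Resolvent

attribute [local instance] Matrix.linftyOpNormedRing Matrix.linftyOpNormedAlgebra

variable {p n : ℕ} {d : Fin p → ℝ} (β : Matrix (Fin n) (Fin n) ℂ)
  (Θ₁ Θ₂ : Matrix (Fin n) (Fin p) ℂ)

theorem entry_congr {ι κ : Type*} {A B : Matrix ι κ ℂ} (h : A = B) (i : ι) (k : κ) :
    A i k = B i k := by
  rw [h]

theorem entry_add_eq_zero {ι κ : Type*} {A B C : Matrix ι κ ℂ} (h : A + B + C = 0) (i : ι) (k : κ) :
    A i k + B i k + C i k = 0 := by
  rw [← Matrix.add_apply, ← Matrix.add_apply, h, Matrix.zero_apply]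

/-- The projection `diag(0, I)`. -/
def lowerProj (n : ℕ) : Matrix (Fin n ⊕ Fin n) (Fin n ⊕ Fin n) ℂ := fromBlocks 0 0 0 1

theorem lowerProj_mul_Px [NeZero p] (l : ℝ) :
    lowerProj n * Px d β Θ₁ Θ₂ l = Px d β Θ₁ Θ₂ l := by
  simp [lowerProj, Px, fromBlocks_multiply]

theorem Px_mul_lowerProj [NeZero p] (l : ℝ) :
    Px d β Θ₁ Θ₂ l * lowerProj n = lowerProj n := by
  simp [lowerProj, Px, fromBlocks_multiply]

/-- This is where `U₂₂⁻¹` matters: the lower row of `U(a)` times `P^×` is `[U₂₂ U₂₂⁻¹ U₂₁, U₂₂]`. -/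
theorem lowerProj_mul_U_mul_Px [NeZero p] {l : ℝ}
    (h : (U d β Θ₁ Θ₂ l (d 0 * l)).toBlocks₂₂.det ≠ 0) :
    lowerProj n * U d β Θ₁ Θ₂ l (d 0 * l) * Px d β Θ₁ Θ₂ l =
      lowerProj n * U d β Θ₁ Θ₂ l (d 0 * l) := by
  rw [Px]
  generalize U d β Θ₁ Θ₂ l (d 0 * l) = M at *
  conv_rhs => rw [← fromBlocks_toBlocks M]
  conv_lhs => rw [← fromBlocks_toBlocks M]
  simp only [lowerProj, fromBlocks_multiply, toBlocks_fromBlocks₂₁, toBlocks_fromBlocks₂₂]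
  simp [Matrix.mul_nonsing_inv_cancel_left _ _ (isUnit_iff_ne_zero.2 h)]

/-- This factorization shows that `P^× U(a)⁻¹` ends in `diag(0, I)`, which yields the fourth
relation. -/
theorem Px_eq_lowerProj [NeZero p] {l : ℝ}
    (h : (U d β Θ₁ Θ₂ l (d 0 * l)).toBlocks₂₂.det ≠ 0) :
    Px d β Θ₁ Θ₂ l = fromBlocks 0 0 0 ((U d β Θ₁ Θ₂ l (d 0 * l)).toBlocks₂₂)⁻¹ *
      lowerProj n * U d β Θ₁ Θ₂ l (d 0 * l) := by
  rw [Px]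
  generalize U d β Θ₁ Θ₂ l (d 0 * l) = M at *
  conv_rhs => rw [← fromBlocks_toBlocks M]
  simp only [lowerProj, fromBlocks_multiply, toBlocks_fromBlocks₂₂]
  simp [Matrix.nonsing_inv_mul _ (isUnit_iff_ne_zero.2 h)]

theorem U_mul_inv (l y : ℝ) : U d β Θ₁ Θ₂ l y * (U d β Θ₁ Θ₂ l y)⁻¹ = 1 :=
  Matrix.mul_nonsing_inv _ ((Matrix.isUnit_iff_isUnit_det _).1 (isUnit_U ..))

theorem Px_mul_U_inv_mul_lowerProj [NeZero p] {l : ℝ}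
    (h : (U d β Θ₁ Θ₂ l (d 0 * l)).toBlocks₂₂.det ≠ 0) :
    Px d β Θ₁ Θ₂ l * (U d β Θ₁ Θ₂ l (d 0 * l))⁻¹ * lowerProj n =
      Px d β Θ₁ Θ₂ l * (U d β Θ₁ Θ₂ l (d 0 * l))⁻¹ := by
  have h2 : lowerProj n * lowerProj n = lowerProj n := by simp [lowerProj, fromBlocks_multiply]
  rw [Px_eq_lowerProj β Θ₁ Θ₂ h]
  rw [Matrix.mul_assoc _ (U d β Θ₁ Θ₂ l (d 0 * l)), U_mul_inv, Matrix.mul_one, Matrix.mul_assoc, h2]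

theorem exp_smul_mul_exp_smul {m : Type*} [Fintype m] [DecidableEq m] (A : Matrix m m ℂ)
    (z w : ℂ) : NormedSpace.exp (z • A) * NormedSpace.exp (w • A) =
      NormedSpace.exp ((z + w) • A) := by
  rw [← Matrix.exp_add_of_commute _ _ (((Commute.refl A).smul_left z).smul_right w), add_smul]

theorem cFun_eq_fromCols (y : ℝ) : cFun β Θ₁ Θ₂ y =
    fromCols (Θ₂ᴴ * NormedSpace.exp ((Complex.I * y) • βᴴ))
      (Θ₁ᴴ * NormedSpace.exp ((Complex.I * y) • β)) := by
  rw [cFun, exp_calA, thetaRow, fromCols_mul_fromBlocks]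
  simp

theorem bFun_eq_fromRows (y : ℝ) : bFun β Θ₁ Θ₂ y =
    fromRows (-(NormedSpace.exp ((Complex.I * -y) • βᴴ) * Θ₁))
      (NormedSpace.exp ((Complex.I * -y) • β) * Θ₂) := by
  rw [bFun, exp_calA, thetaCol, fromBlocks_mul_fromRows]
  simp

/-- The group law splits `exp(i(y - r)β*)` and `exp(i(y - r)β)` into a factor in `y` and one in `r`;
the upper block serves `r < y` and the lower block `r ≥ y`. The minus sign in `-cFun` offsets the
one in `[-Θ₁; Θ₂]`. -/
theorem kKer_eq_semiKer (d : Fin p → ℝ) : kKer d β Θ₁ Θ₂ =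
    semiKer d (fun y => -cFun β Θ₁ Θ₂ y) (lowerProj n) (bFun β Θ₁ Θ₂) := by
  funext x t
  ext i j
  simp only [kKer, semiKer, of_apply]
  generalize d i * x = y
  generalize d j * t = r
  refine entry_congr ?_ i j
  have h1 : ∀ A : Matrix (Fin n) (Fin n) ℂ, NormedSpace.exp ((Complex.I * y) • A) *
      NormedSpace.exp ((Complex.I * -r) • A) = NormedSpace.exp ((Complex.I * (y - r : ℝ)) • A) :=
    fun A => by
      rw [exp_smul_mul_exp_smul]
      congr 2
      push_cast
      ring
  rw [kFun, stepFun, cFun_eq_fromCols, bFun_eq_fromRows]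
  by_cases h : r < y
  · have h' : (1 : Matrix (Fin n ⊕ Fin n) (Fin n ⊕ Fin n) ℂ) - lowerProj n =
        fromBlocks 1 0 0 0 := by
      rw [← fromBlocks_one, lowerProj, sub_eq_add_neg, fromBlocks_neg, fromBlocks_add]
      simp
    rw [if_pos (sub_pos.2 h), if_pos h, h', Matrix.neg_mul, fromCols_mul_fromBlocks, Matrix.neg_mul,
      fromCols_mul_fromRows, ← h1]
    simp [Matrix.mul_assoc]
  · rw [if_neg (by simpa using h), if_neg h, zero_sub, lowerProj, Matrix.neg_mul, Matrix.mul_neg, neg_neg,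
      fromCols_mul_fromBlocks, fromCols_mul_fromRows]
    have h2 : (NormedSpace.exp ((Complex.I * ((-(y - r) : ℝ) : ℂ)) • βᴴ))ᴴ =
        NormedSpace.exp ((Complex.I * y) • β) * NormedSpace.exp ((Complex.I * -r) • β) := by
      rw [h1, ← Matrix.exp_conjTranspose, conjTranspose_smul, conjTranspose_conjTranspose]
      congr 2
      simp
      ring
    rw [conjTranspose_mul, conjTranspose_mul, h2]
    simp [Matrix.mul_assoc]

theorem TKer_eq_semiKer [NeZero p] (d : Fin p → ℝ) (l : ℝ) : TKer d β Θ₁ Θ₂ l =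
    semiKer d (fun y => cFun β Θ₁ Θ₂ y * U d β Θ₁ Θ₂ l y) (Px d β Θ₁ Θ₂ l)
      (fun y => (U d β Θ₁ Θ₂ l y)⁻¹ * bFun β Θ₁ Θ₂ y) := by
  funext x t
  ext i j
  simp only [TKer, semiKer, of_apply, stepFun, cFun, bFun]
  split_ifs
  · simp only [Matrix.mul_assoc]
  · simp only [Matrix.mul_assoc, zero_sub, Matrix.mul_neg, Matrix.neg_mul, Matrix.neg_apply]

theorem continuous_cFun_mul_U (hd0 : ∀ i, 0 < d i) {l : ℝ} (hl : 0 ≤ l) :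
    Continuous fun y => cFun β Θ₁ Θ₂ y * U d β Θ₁ Θ₂ l y :=
  (continuous_cFun β Θ₁ Θ₂).matrix_mul (continuous_U β Θ₁ Θ₂ hd0 hl)

theorem continuous_U_inv_mul_bFun (hd0 : ∀ i, 0 < d i) {l : ℝ} (hl : 0 ≤ l) :
    Continuous fun y => (U d β Θ₁ Θ₂ l y)⁻¹ * bFun β Θ₁ Θ₂ y :=
  (continuous_U_inv β Θ₁ Θ₂ hd0 hl).matrix_mul (continuous_bFun β Θ₁ Θ₂)

theorem isBoundedKernel_kKer (d : Fin p → ℝ) (l : ℝ) : IsBoundedKernel l (kKer d β Θ₁ Θ₂) := by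
  rw [kKer_eq_semiKer]
  exact isBoundedKernel_semiKer d l (continuous_cFun β Θ₁ Θ₂).neg (continuous_bFun β Θ₁ Θ₂) _

theorem isBoundedKernel_TKer [NeZero p] (hd0 : ∀ i, 0 < d i) {l : ℝ} (hl : 0 ≤ l) :
    IsBoundedKernel l (TKer d β Θ₁ Θ₂ l) := by
  rw [TKer_eq_semiKer]
  exact isBoundedKernel_semiKer d l (continuous_cFun_mul_U β Θ₁ Θ₂ hd0 hl)
    (continuous_U_inv_mul_bFun β Θ₁ Θ₂ hd0 hl) _

theorem mul_mem_Icc [NeZero p] (hd : Antitone d) (hd0 : ∀ i, 0 < d i) {l x : ℝ}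
    (hx : x ∈ Set.Icc 0 l) (i : Fin p) : d i * x ∈ Set.Icc 0 (d 0 * l) :=
  ⟨mul_nonneg (hd0 i).le hx.1, mul_le_mul (hd (Fin.zero_le i)) hx.2 hx.1 (hd0 0).le⟩

theorem stepFun_mul_comm {R : Type*} [Ring R] (r y : ℝ) (a : R) :
    stepFun R r y * a = a * stepFun R r y := by
  rw [stepFun]
  split_ifs <;> simp

variable {β Θ₁ Θ₂}

/-- The composition formula applies with antiderivative `U`. -/
theorem kKer_add_TKer_add_comp [NeZero p] (hd : Antitone d) (hd0 : ∀ i, 0 < d i) {l : ℝ}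
    (hl : 0 < l) (h : (U d β Θ₁ Θ₂ l (d 0 * l)).toBlocks₂₂.det ≠ 0) {x t : ℝ}
    (hx : x ∈ Set.Icc 0 l) (ht : t ∈ Set.Icc 0 l) (i k : Fin p) :
    kKer d β Θ₁ Θ₂ x t i k + TKer d β Θ₁ Θ₂ l x t i k +
      ∑ j, ∫ s in (0 : ℝ)..l, kKer d β Θ₁ Θ₂ x s i j * TKer d β Θ₁ Θ₂ l s t j k = 0 := by
  have e1 := lowerProj_mul_Px (d := d) β Θ₁ Θ₂ l
  have e2 := lowerProj_mul_U_mul_Px β Θ₁ Θ₂ h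
  have key := sum_integral_step_mul_step hd hd0 hl.le (continuous_bFun β Θ₁ Θ₂)
    (continuous_cFun_mul_U β Θ₁ Θ₂ hd0 hl.le) (continuous_U β Θ₁ Θ₂ hd0 hl.le)
    (fun y hy => by
      have := hasDerivAt_U β Θ₁ Θ₂ hd0 hl.le hy
      rwa [mFun, Matrix.mul_assoc] at this)
    (mul_mem_Icc hd hd0 hx i) (mul_mem_Icc hd hd0 ht k) (lowerProj n) (Px d β Θ₁ Θ₂ l)
    (-cFun β Θ₁ Θ₂ (d i * x)) ((U d β Θ₁ Θ₂ l (d k * t))⁻¹ * bFun β Θ₁ Θ₂ (d k * t)) i k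
  rw [TKer_eq_semiKer, kKer_eq_semiKer]
  simp only [semiKer, of_apply]
  rw [key, U_zero β Θ₁ Θ₂ hd0 hl.le]
  -- With `b = U (U⁻¹ b)` all three terms acquire the common right factor `U⁻¹ b`.
  have hUV : bFun β Θ₁ Θ₂ (d k * t) = U d β Θ₁ Θ₂ l (d k * t) *
      ((U d β Θ₁ Θ₂ l (d k * t))⁻¹ * bFun β Θ₁ Θ₂ (d k * t)) := by
    rw [← Matrix.mul_assoc, U_mul_inv, Matrix.one_mul]
  refine entry_add_eq_zero ?_ i k
  nth_rw 1 [hUV]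
  generalize (U d β Θ₁ Θ₂ l (d k * t))⁻¹ * bFun β Θ₁ Θ₂ (d k * t) = Z
  have hs := stepFun_mul_comm (d k * t) (d i * x) (U d β Θ₁ Θ₂ l (d i * x))
  generalize U d β Θ₁ Θ₂ l (d i * x) = Uy at *
  generalize U d β Θ₁ Θ₂ l (d k * t) = Ur at *
  generalize U d β Θ₁ Θ₂ l (d 0 * l) = Ua at *
  generalize stepFun (Matrix (Fin n ⊕ Fin n) (Fin n ⊕ Fin n) ℂ) (d k * t) (d i * x) = χ at *
  generalize Px d β Θ₁ Θ₂ l = Q at *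
  generalize lowerProj n = P at *
  -- By `e1` and `e2` the boundary terms at `0` and `a` cancel; what remains is the difference of
  -- the two middle factors.
  have hb : χ * (Uy - Ur) - (Uy - 1) * Q - P * (Ua - Ur) + P * (Ua - 1) * Q =
      Uy * (χ - Q) - (χ - P) * Ur := by
    simp only [Matrix.mul_sub, Matrix.sub_mul, Matrix.one_mul, Matrix.mul_one, e1, e2, hs]
    abel
  rw [hb]
  simp only [Matrix.mul_sub, Matrix.sub_mul, Matrix.neg_mul, Matrix.mul_assoc]
  abel

theorem hasDerivAt_U_inv (hd0 : ∀ i, 0 < d i) {l : ℝ} (hl : 0 ≤ l) {y : ℝ}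
    (hy : y ∉ Set.range fun j => d j * l) :
    HasDerivAt (fun y => (U d β Θ₁ Θ₂ l y)⁻¹)
      ((U d β Θ₁ Θ₂ l y)⁻¹ * bFun β Θ₁ Θ₂ y * wMat d l y * -cFun β Θ₁ Θ₂ y) y := by
  have := (hasDerivAt_neg_U_inv β Θ₁ Θ₂ hd0 hl hy).fun_neg
  simp only [neg_neg] at this
  refine this.congr_deriv ?_
  rw [mFun, Matrix.mul_neg]
  simp only [Matrix.mul_assoc]

/-- The mirror computation, with antiderivative `U⁻¹` and the two relations in which `P^×` stands on
the left. -/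
theorem TKer_add_kKer_add_comp [NeZero p] (hd : Antitone d) (hd0 : ∀ i, 0 < d i) {l : ℝ}
    (hl : 0 < l) (h : (U d β Θ₁ Θ₂ l (d 0 * l)).toBlocks₂₂.det ≠ 0) {x t : ℝ}
    (hx : x ∈ Set.Icc 0 l) (ht : t ∈ Set.Icc 0 l) (i k : Fin p) :
    TKer d β Θ₁ Θ₂ l x t i k + kKer d β Θ₁ Θ₂ x t i k +
      ∑ j, ∫ s in (0 : ℝ)..l, TKer d β Θ₁ Θ₂ l x s i j * kKer d β Θ₁ Θ₂ s t j k = 0 := by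
  have e1 := Px_mul_lowerProj (d := d) β Θ₁ Θ₂ l
  have e2 := Px_mul_U_inv_mul_lowerProj β Θ₁ Θ₂ h
  have key := sum_integral_step_mul_step hd hd0 hl.le (continuous_U_inv_mul_bFun β Θ₁ Θ₂ hd0 hl.le)
    (X₂ := fun y => -cFun β Θ₁ Θ₂ y) (continuous_cFun β Θ₁ Θ₂).neg (continuous_U_inv β Θ₁ Θ₂ hd0 hl.le)
    (fun y hy => hasDerivAt_U_inv hd0 hl.le hy)
    (mul_mem_Icc hd hd0 hx i) (mul_mem_Icc hd hd0 ht k) (Px d β Θ₁ Θ₂ l) (lowerProj n)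
    (cFun β Θ₁ Θ₂ (d i * x) * U d β Θ₁ Θ₂ l (d i * x)) (bFun β Θ₁ Θ₂ (d k * t)) i k
  rw [TKer_eq_semiKer, kKer_eq_semiKer]
  simp only [semiKer, of_apply]
  rw [key, U_zero β Θ₁ Θ₂ hd0 hl.le, inv_one]
  refine entry_add_eq_zero ?_ i k
  generalize bFun β Θ₁ Θ₂ (d k * t) = b
  have hs := stepFun_mul_comm (d k * t) (d i * x) ((U d β Θ₁ Θ₂ l (d i * x))⁻¹)
  have hUV := U_mul_inv (d := d) β Θ₁ Θ₂ l (d i * x)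
  generalize (U d β Θ₁ Θ₂ l (d i * x))⁻¹ = Vy at *
  generalize U d β Θ₁ Θ₂ l (d i * x) = Uy at *
  generalize (U d β Θ₁ Θ₂ l (d k * t))⁻¹ = Vr at *
  generalize (U d β Θ₁ Θ₂ l (d 0 * l))⁻¹ = Va at *
  generalize stepFun (Matrix (Fin n ⊕ Fin n) (Fin n ⊕ Fin n) ℂ) (d k * t) (d i * x) = χ at *
  generalize Px d β Θ₁ Θ₂ l = Q at *
  generalize lowerProj n = P at *
  have hb : χ * (Vy - Vr) - (Vy - 1) * P - Q * (Va - Vr) + Q * (Va - 1) * P =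
      Vy * (χ - P) - (χ - Q) * Vr := by
    simp only [Matrix.mul_sub, Matrix.sub_mul, Matrix.one_mul, Matrix.mul_one, e1, e2, hs]
    abel
  have hUV' : ∀ {κ : Type} (X : Matrix (Fin n ⊕ Fin n) κ ℂ), Uy * (Vy * X) = X := fun X => by
    rw [← Matrix.mul_assoc, hUV, Matrix.one_mul]
  rw [hb]
  simp only [Matrix.mul_sub, Matrix.sub_mul, Matrix.neg_mul, Matrix.mul_assoc, hUV']
  abel

end Resolvent

/-! ### The formula for `γ`. -/

section Gamma

attribute [local instance] Matrix.linftyOpNormedRing Matrix.linftyOpNormedAlgebra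

variable {p n : ℕ} {d : Fin p → ℝ} {β : Matrix (Fin n) (Fin n) ℂ} {Θ₁ Θ₂ : Matrix (Fin n) (Fin p) ℂ}

/-- An antiderivative of `exp(iuA)` is `-i exp(iuA) A⁻¹`. -/
theorem integral_exp_entry {m : Type*} [Fintype m] [DecidableEq m] {A : Matrix m m ℂ}
    (hA : IsUnit A.det) (x : ℝ) (i j : m) :
    ∫ u in (0 : ℝ)..x, NormedSpace.exp ((Complex.I * (u : ℂ)) • A) i j =
      (-Complex.I • ((NormedSpace.exp ((Complex.I * (x : ℂ)) • A) - 1) * A⁻¹)) i j := by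
  have hcomm : ∀ u : ℝ, (Complex.I * (u : ℂ)) • A = (u : ℂ) • (Complex.I • A) := fun u => by
    rw [smul_smul, mul_comm]
  simp only [hcomm]
  let ψ₀ : Matrix m m ℂ →ₗ[ℝ] ℂ :=
    { toFun := fun M => (-Complex.I • (M * A⁻¹)) i j
      map_add' := fun M N => by simp [Matrix.add_mul, mul_add]
      map_smul' := fun c M => by simp [mul_left_comm] }
  let ψ := LinearMap.toContinuousLinearMap ψ₀
  have hd : ∀ u : ℝ, HasDerivAt (fun u : ℝ => ψ (NormedSpace.exp ((u : ℂ) • (Complex.I • A))))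
      (NormedSpace.exp ((u : ℂ) • (Complex.I • A)) i j) u := fun u => by
    refine (ψ.hasFDerivAt.comp_hasDerivAt u
      (hasDerivAt_exp_ofReal_smul (Complex.I • A) u)).congr_deriv ?_
    refine entry_congr (A := -Complex.I • (NormedSpace.exp ((u : ℂ) • (Complex.I • A)) *
      (Complex.I • A) * A⁻¹)) ?_ i j
    rw [Matrix.mul_smul, Matrix.smul_mul, smul_smul, neg_mul, Complex.I_mul_I, neg_neg, one_smul,
      Matrix.mul_assoc, Matrix.mul_nonsing_inv _ hA, Matrix.mul_one]
  rw [intervalIntegral.integral_eq_sub_of_hasDerivAt (fun u _ => hd u)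
    (((continuous_exp_ofReal_smul (Complex.I • A)).matrix_elem i j).intervalIntegrable _ _),
    ← map_sub, Complex.ofReal_zero, zero_smul, NormedSpace.exp_zero]
  rfl

/-- The factor `d j` cancels `D⁻¹`; the lower limit of the integral supplies the constant
`iΘ₂*(β*)⁻¹Θ₁`, the upper limit the exponential term. -/
theorem Phi1_eq (hd0 : ∀ i, 0 < d i) (hβ : IsUnit βᴴ.det) (t : ℝ) (j k : Fin p) :
    Phi1 d β Θ₁ Θ₂ t j k =
      ((1 / 2 : ℂ) • dMat d + Complex.I • (Θ₂ᴴ * (βᴴ)⁻¹ * Θ₁)) j k - Complex.I *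
        (Θ₂ᴴ * NormedSpace.exp ((Complex.I * ((d j * t : ℝ) : ℂ)) • βᴴ) * (βᴴ)⁻¹ * Θ₁) j k := by
  have hdj : (d j : ℂ) ≠ 0 := by exact_mod_cast (hd0 j).ne'
  simp only [Phi1, sFun, integral_exp_entry hβ, of_apply]
  generalize NormedSpace.exp ((Complex.I * ((d j * t : ℝ) : ℂ)) • βᴴ) = E
  have h1 : (Matrix.of fun i j => (-Complex.I • ((E - 1) * (βᴴ)⁻¹)) i j) =
      -Complex.I • ((E - 1) * (βᴴ)⁻¹) := rfl
  rw [h1, dMat_inv hd0, Matrix.mul_assoc, Matrix.mul_assoc, Matrix.add_apply, diagonal_mul,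
    Matrix.sub_mul, Matrix.one_mul, Matrix.smul_mul, Matrix.mul_smul, Matrix.sub_mul,
    Matrix.mul_sub, Matrix.add_apply, Matrix.smul_apply, Matrix.smul_apply, Matrix.smul_apply,
    Matrix.smul_apply, Matrix.sub_apply]
  simp only [Matrix.mul_assoc, smul_eq_mul]
  have h2 : (d j : ℂ) * (1 : Matrix (Fin p) (Fin p) ℂ) j k = dMat d j k := by
    by_cases h : j = k
    · subst h; simp [dMat]
    · simp [dMat, h]
  rw [← h2]
  field_simp
  ring

theorem cFun_mul_fromRows (y : ℝ) :
    cFun β Θ₁ Θ₂ y * fromRows (1 : Matrix (Fin n) (Fin n) ℂ) (0 : Matrix (Fin n) (Fin n) ℂ) =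
      Θ₂ᴴ * NormedSpace.exp ((Complex.I * y) • βᴴ) := by
  rw [cFun_eq_fromCols, fromCols_mul_fromRows, Matrix.mul_one, Matrix.mul_zero, add_zero]

theorem intervalIntegrable_semiKer_mul {m : Type*} [Fintype m] [DecidableEq m] (d : Fin p → ℝ)
    {X : ℝ → Matrix (Fin p) m ℂ} {Y : ℝ → Matrix m (Fin p) ℂ} (hY : Continuous Y)
    (Q : Matrix m m ℂ) (x : ℝ) (i j : Fin p) {g : ℝ → ℂ} (hg : Continuous g) (u v : ℝ) :
    IntervalIntegrable (fun t => semiKer d X Q Y x t i j * g t) volume u v := by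
  let f : Matrix m m ℂ → ℝ → ℂ := fun A t => (X (d i * x) * A * Y (d j * t)) i j * g t
  have hf : ∀ A, IntervalIntegrable (f A) volume u v := fun A => Continuous.intervalIntegrable
    (((continuous_const.matrix_mul (hY.comp (continuous_const.mul continuous_id))).matrix_elem
      i j).mul hg) _ _
  have h : (fun t => semiKer d X Q Y x t i j * g t) = fun t =>
      if t ∈ {t | d j * t < d i * x} then f (1 - Q) t else f (0 - Q) t := by
    ext t
    simp only [semiKer, stepFun, of_apply, f, Set.mem_ofPred_eq]
    split_ifs <;> rfl
  rw [h]
  exact intervalIntegrable_ite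
    (measurableSet_lt (measurable_const.mul measurable_id) measurable_const) (hf _) (hf _)

theorem intervalIntegrable_TKer_mul [NeZero p] (hd0 : ∀ i, 0 < d i) {l : ℝ} (hl : 0 ≤ l) (x : ℝ)
    (i j : Fin p) {g : ℝ → ℂ} (hg : Continuous g) (u v : ℝ) :
    IntervalIntegrable (fun t => TKer d β Θ₁ Θ₂ l x t i j * g t) volume u v := by
  rw [TKer_eq_semiKer]
  exact intervalIntegrable_semiKer_mul d (continuous_U_inv_mul_bFun β Θ₁ Θ₂ hd0 hl) _ x i j hg u v

/-- `γ₀` is the image under `V_+^*` of the function with rows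
`Θ₂* exp(i d_j t β*) (β*)⁻¹ Θ₁`. -/
theorem gamma0_eq [NeZero p] (hd : Antitone d) (hd0 : ∀ i, 0 < d i) {x : ℝ} (hx : 0 ≤ x)
    (s k : Fin p) :
    (Θ₂ᴴ * NormedSpace.exp ((Complex.I * ((d s * x : ℝ) : ℂ)) • βᴴ) * (βᴴ)⁻¹ * Θ₁) s k +
      ∑ j, ∫ r in (0 : ℝ)..x, TKer d β Θ₁ Θ₂ x x r s j *
        (Θ₂ᴴ * NormedSpace.exp ((Complex.I * ((d j * r : ℝ) : ℂ)) • βᴴ) * (βᴴ)⁻¹ * Θ₁) j k =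
    gamma0 d β Θ₁ Θ₂ x s k := by
  have hmem := mul_mem_Icc hd hd0 (Set.right_mem_Icc.2 hx) s
  -- The exponential is treated as a degenerate kernel with `r = 0` and `Q₂ = 0`, whose Heaviside
  -- factor is `1` on the open interval.
  have key := sum_integral_step_mul_step (κ := Fin p) (F := fun y => -(U d β Θ₁ Θ₂ x y)⁻¹) hd hd0 hx
    (continuous_U_inv_mul_bFun β Θ₁ Θ₂ hd0 hx) (continuous_cFun β Θ₁ Θ₂)
    (continuous_U_inv β Θ₁ Θ₂ hd0 hx).neg
    (fun y hy => by
      have := hasDerivAt_neg_U_inv β Θ₁ Θ₂ hd0 hx hy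
      rwa [mFun, ← Matrix.mul_assoc, ← Matrix.mul_assoc] at this)
    hmem (Set.left_mem_Icc.2 (hmem.1.trans hmem.2)) (Px d β Θ₁ Θ₂ x) 0
    (cFun β Θ₁ Θ₂ (d s * x) * U d β Θ₁ Θ₂ x (d s * x))
    (fromRows (1 : Matrix (Fin n) (Fin n) ℂ) (0 : Matrix (Fin n) (Fin n) ℂ) * ((βᴴ)⁻¹ * Θ₁)) s k
  have hint : ∀ j, ∫ r in (0 : ℝ)..x, TKer d β Θ₁ Θ₂ x x r s j *
        (Θ₂ᴴ * NormedSpace.exp ((Complex.I * ((d j * r : ℝ) : ℂ)) • βᴴ) * (βᴴ)⁻¹ * Θ₁) j k =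
      ∫ r in (0 : ℝ)..x, (cFun β Θ₁ Θ₂ (d s * x) * U d β Θ₁ Θ₂ x (d s * x) *
        (stepFun (Matrix (Fin n ⊕ Fin n) (Fin n ⊕ Fin n) ℂ) (d j * r) (d s * x) -
          Px d β Θ₁ Θ₂ x) *
          ((U d β Θ₁ Θ₂ x (d j * r))⁻¹ * bFun β Θ₁ Θ₂ (d j * r))) s j *
        (cFun β Θ₁ Θ₂ (d j * r) * (stepFun (Matrix (Fin n ⊕ Fin n) (Fin n ⊕ Fin n) ℂ) 0 (d j * r)
          - (0 : Matrix (Fin n ⊕ Fin n) (Fin n ⊕ Fin n) ℂ)) * (fromRows (1 : Matrix (Fin n) (Fin n) ℂ) (0 : Matrix (Fin n) (Fin n) ℂ) *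
            ((βᴴ)⁻¹ * Θ₁))) j k := fun j => by
    refine intervalIntegral.integral_congr_Ioo_of_le hx fun r hr => ?_
    have h1 : stepFun (Matrix (Fin n ⊕ Fin n) (Fin n ⊕ Fin n) ℂ) 0 (d j * r) = 1 :=
      if_pos (mul_pos (hd0 j) hr.1)
    simp only [TKer_eq_semiKer, semiKer, of_apply, h1, sub_zero, Matrix.mul_one]
    rw [← Matrix.mul_assoc (cFun β Θ₁ Θ₂ (d j * r)), cFun_mul_fromRows]
    simp only [Matrix.mul_assoc]
  have hstep : stepFun (Matrix (Fin n ⊕ Fin n) (Fin n ⊕ Fin n) ℂ) 0 (d s * x) *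
      (-(U d β Θ₁ Θ₂ x (d s * x))⁻¹ - -(U d β Θ₁ Θ₂ x 0)⁻¹) =
      1 - (U d β Θ₁ Θ₂ x (d s * x))⁻¹ := by
    -- At `d s * x = 0` the Heaviside factor is `0`, but the right side vanishes too, since `U 0 =
    -- 1`.
    rcases hmem.1.eq_or_lt with h | h
    · rw [← h, U_zero β Θ₁ Θ₂ hd0 hx]
      simp
    · rw [stepFun, if_pos h, Matrix.one_mul, U_zero β Θ₁ Θ₂ hd0 hx, inv_one]
      abel
  rw [Finset.sum_congr rfl fun j _ => hint j, key, hstep, U_zero β Θ₁ Θ₂ hd0 hx, inv_one]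
  have hcU : thetaRow Θ₁ Θ₂ * NormedSpace.exp (((d s * x : ℝ) : ℂ) • calA β) =
    cFun β Θ₁ Θ₂ (d s * x) := rfl
  rw [gamma0, of_apply, hcU, ← Matrix.add_apply]
  refine entry_congr ?_ s k
  generalize (U d β Θ₁ Θ₂ x (d s * x))⁻¹ = V
  generalize (U d β Θ₁ Θ₂ x (d 0 * x))⁻¹ = Va
  have hQ : (1 - V - (-V - -1) * 0 - Px d β Θ₁ Θ₂ x * (-Va - -1) + Px d β Θ₁ Θ₂ x * (-Va - -1) * 0) =
      Px d β Θ₁ Θ₂ x * Va - V + 1 - Px d β Θ₁ Θ₂ x := by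
    noncomm_ring
  rw [hQ]
  generalize Px d β Θ₁ Θ₂ x * Va - V + 1 - Px d β Θ₁ Θ₂ x = W
  simp only [Matrix.add_mul, Matrix.mul_assoc]

theorem VStar_apply [NeZero p] {κ : Type} (hd0 : ∀ i, 0 < d i) {f : ℝ → Matrix (Fin p) κ ℂ} {x : ℝ}
    (hx : 0 ≤ x) (k : κ) (hf : ∀ j, Continuous fun r => f r j k) (s : Fin p) :
    VStar d β Θ₁ Θ₂ f x s k = f x s k +
      ∑ j, ∫ r in (0 : ℝ)..x, TKer d β Θ₁ Θ₂ x x r s j * f r j k := by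
  rw [VStar, Matrix.add_apply, of_apply]
  simp only [Matrix.mul_apply]
  rw [intervalIntegral.integral_finsetSum fun j _ =>
    intervalIntegrable_TKer_mul hd0 hx x s j (hf j) 0 x]

/-- By `Phi1_eq` and linearity of `V_+^*`, the left block splits into a constant and an exponential
part, the latter giving `γ₀`; the right block is the same on both sides. -/
theorem gamma_eq [NeZero p] (hd : Antitone d) (hd0 : ∀ i, 0 < d i) (hβ : β.det ≠ 0) {x : ℝ}
    (hx : 0 ≤ x) :
    gamma d β Θ₁ Θ₂ x = VStar d β Θ₁ Θ₂ (fun _ => fromCols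
      ((1 / 2 : ℂ) • dMat d + Complex.I • (Θ₂ᴴ * (βᴴ)⁻¹ * Θ₁)) (1 : Matrix (Fin p) (Fin p) ℂ)) x
      - Complex.I • fromCols (gamma0 d β Θ₁ Θ₂ x) (0 : Matrix (Fin p) (Fin p) ℂ) := by
  have hβ' : IsUnit βᴴ.det := by
    rw [det_conjTranspose]
    exact (isUnit_iff_ne_zero.2 hβ).star
  ext s (k | k)
  · set c₀ := (1 / 2 : ℂ) • dMat d + Complex.I • (Θ₂ᴴ * (βᴴ)⁻¹ * Θ₁) with hc₀
    let w : Fin p → ℝ → ℂ := fun j t =>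
      (Θ₂ᴴ * NormedSpace.exp ((Complex.I * ((d j * t : ℝ) : ℂ)) • βᴴ) * (βᴴ)⁻¹ * Θ₁) j k
    have hw : ∀ j, Continuous (w j) := fun j => by
      have h1 : Continuous fun t : ℝ =>
          NormedSpace.exp ((Complex.I * ((d j * t : ℝ) : ℂ)) • βᴴ) := by
        have h : Continuous fun t : ℝ =>
            NormedSpace.exp (((d j * t : ℝ) : ℂ) • (Complex.I • βᴴ)) :=
          (continuous_exp_ofReal_smul (Complex.I • βᴴ)).comp (continuous_const.mul continuous_id)
        simpa only [smul_smul, mul_comm Complex.I] using h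
      exact (((continuous_const.matrix_mul h1).matrix_mul continuous_const).matrix_mul
        continuous_const).matrix_elem j k
    have hPhi : ∀ t j, Phi1 d β Θ₁ Θ₂ t j k = c₀ j k - Complex.I * w j t := fun t j =>
      Phi1_eq hd0 hβ' t j k
    have hPhic : ∀ j, Continuous fun t => Phi1 d β Θ₁ Θ₂ t j k := fun j => by
      simp only [hPhi]
      exact continuous_const.sub (continuous_const.mul (hw j))
    rw [gamma, VStar_apply hd0 hx (Sum.inl k) (by simpa using hPhic), Matrix.sub_apply,
      VStar_apply hd0 hx (Sum.inl k) (by simpa using fun _ => continuous_const), Matrix.smul_apply]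
    simp only [fromCols_apply_inl]
    rw [← gamma0_eq hd hd0 hx s k, hPhi]
    have h2 : ∀ j, ∫ r in (0 : ℝ)..x, TKer d β Θ₁ Θ₂ x x r s j * Phi1 d β Θ₁ Θ₂ r j k =
        (∫ r in (0 : ℝ)..x, TKer d β Θ₁ Θ₂ x x r s j * c₀ j k) -
          Complex.I * ∫ r in (0 : ℝ)..x, TKer d β Θ₁ Θ₂ x x r s j * w j r := fun j => by
      rw [← intervalIntegral.integral_const_mul, ← intervalIntegral.integral_sub
        (intervalIntegrable_TKer_mul hd0 hx x s j continuous_const 0 x)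
        ((intervalIntegrable_TKer_mul hd0 hx x s j (hw j) 0 x).const_mul _)]
      refine intervalIntegral.integral_congr fun r _ => ?_
      simp only [hPhi]
      ring
    rw [Finset.sum_congr rfl fun j _ => h2 j, Finset.sum_sub_distrib, ← Finset.mul_sum, smul_eq_mul]
    ring
  · rw [gamma, VStar_apply hd0 hx (Sum.inr k) (by simpa using fun _ => continuous_const),
      Matrix.sub_apply, VStar_apply hd0 hx (Sum.inr k) (by simpa using fun _ => continuous_const)]
    simp

end Gamma

/-! ### Conclusion: the inverse operators and the theorem. -/

/-- The operators with kernels `k` and `T_l` are inverse to each other. -/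
theorem exists_inverse_operators {p n : ℕ} [NeZero p] {d : Fin p → ℝ} (hd : Antitone d)
    (hd0 : ∀ i, 0 < d i) {β : Matrix (Fin n) (Fin n) ℂ} {Θ₁ Θ₂ : Matrix (Fin n) (Fin p) ℂ} {l : ℝ}
    (hl : 0 < l) (h : (U d β Θ₁ Θ₂ l (d 0 * l)).toBlocks₂₂.det ≠ 0) :
    ∃ S R : L2 p l →L[ℂ] L2 p l,
      IsIdPlusIntegral l (kKer d β Θ₁ Θ₂) S ∧ IsIdPlusIntegral l (TKer d β Θ₁ Θ₂ l) R ∧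
      S ∘L R = ContinuousLinearMap.id ℂ (L2 p l) ∧ R ∘L S = ContinuousLinearMap.id ℂ (L2 p l) := by
  have hk := isBoundedKernel_kKer β Θ₁ Θ₂ d l
  have hT := isBoundedKernel_TKer β Θ₁ Θ₂ hd0 hl.le
  obtain ⟨S, hS⟩ := hk.exists_isIdPlusIntegral hl
  obtain ⟨R, hR⟩ := hT.exists_isIdPlusIntegral hl
  exact ⟨S, R, hS, hR,
    hk.comp_eq_id hl hT (fun x hx t ht i k => kKer_add_TKer_add_comp hd hd0 hl h
      (Set.Ioo_subset_Icc_self hx) (Set.Ioo_subset_Icc_self ht) i k) hS hR,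
    hT.comp_eq_id hl hk (fun x hx t ht i k => TKer_add_kKer_add_comp hd hd0 hl h
      (Set.Ioo_subset_Icc_self hx) (Set.Ioo_subset_Icc_self ht) i k) hR hS⟩

end DDifference

theorem mainTheorem6 (p n : ℕ) [NeZero p] (d : Fin p → ℝ) (hd : Antitone d) (hd0 : ∀ i, 0 < d i)
    (φ : ℂ → Matrix (Fin p) (Fin p) ℂ) (hrat : DDifference.IsRational φ)
    (hlim : Tendsto φ (cocompact ℂ) (𝓝 ((Complex.I / 2) • DDifference.dMat d)))
    (him : ∀ z : ℂ, 0 < z.im → (DDifference.imPart (φ z)).PosSemidef)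
    (β : Matrix (Fin n) (Fin n) ℂ) (Θ₁ Θ₂ : Matrix (Fin n) (Fin p) ℂ)
    (hreal : DDifference.IsRealization d φ β Θ₁ Θ₂) (hβ : β.det ≠ 0) :
    (∀ l : ℝ, 0 < l →
      (DDifference.U d β Θ₁ Θ₂ l (d 0 * l)).toBlocks₂₂.det ≠ 0 ∧
      ∃ S R : DDifference.L2 p l →L[ℂ] DDifference.L2 p l,
        DDifference.IsIdPlusIntegral l (DDifference.kKer d β Θ₁ Θ₂) S ∧
        DDifference.IsIdPlusIntegral l (DDifference.TKer d β Θ₁ Θ₂ l) R ∧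
        S ∘L R = ContinuousLinearMap.id ℂ (DDifference.L2 p l) ∧
        R ∘L S = ContinuousLinearMap.id ℂ (DDifference.L2 p l)) ∧
    ∀ x : ℝ, 0 ≤ x →
      DDifference.gamma d β Θ₁ Θ₂ x =
        DDifference.VStar d β Θ₁ Θ₂
          (fun _ => fromCols
            ((1 / 2 : ℂ) • DDifference.dMat d + Complex.I • (Θ₂ᴴ * (βᴴ)⁻¹ * Θ₁))
            (1 : Matrix (Fin p) (Fin p) ℂ)) x
          - Complex.I • fromCols (DDifference.gamma0 d β Θ₁ Θ₂ x)
              (0 : Matrix (Fin p) (Fin p) ℂ) := by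
  exact ⟨fun l hl => have h := DDifference.det_U₂₂_ne_zero hd0 hreal.2 hl.le (mul_nonneg (hd0 0).le hl.le)
    ⟨h, DDifference.exists_inverse_operators hd hd0 hl h⟩,
    fun x hx => DDifference.gamma_eq hd hd0 hβ hx⟩
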